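/- Let $K$ be a field of characteristic $0$, let $n\ge 2$ and let $q\in K$ with $q\neq 0$. Let $M_q(n)$ be the standard quantized matrix algebra, that is, the associative unital $K$-algebra generated by $z_{ij}$ ($1\le i,j\le n$) subject to the relations $$\begin{array}{ll} z_{ij}z_{ik}=q\,z_{ik}z_{ij} & \text{if } j<k,\\ z_{ij}z_{kj}=q\,z_{kj}z_{ij} & \text{if } i<k,\\ z_{ij}z_{st}=z_{st}z_{ij} & \text{if } i<s,\ t<j,\\ z_{ij}z_{st}=z_{st}z_{ij}+(q-q^{-1})\,z_{it}z_{sj} & \text{if } i<s,\ j<t. \end{array}$$ Let $M_q(n)_d$ be the $K$-span of the words of length $d$ in the $z_{ij}$. Then: (i) $M_q(n)=\bigoplus_{d\ge 0}M_q(n)_d$ is an $\mathbb N$-graded algebra with $M_q(n)_0=K$ and finite-dimensional components, and its Hilbert series $\sum_{d\ge 0}\dim_K M_q(n)_d\,t^d$ is $\dfrac{1}{(1-t)^{n^2}}$. (ii) The Gelfand–Kirillov dimension of $M_q(n)$, i.e. $\sup_V\limsup_{m\to\infty}\log_m\dim_K(K+V+\cdots+V^m)$ over the finite-dimensional subspaces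 $V\subseteq M_q(n)$, is $n^2$. (iii) The (left and right) global homological dimension of $M_q(n)$ is $n^2$. (iv) With this gradation, $M_q(n)$ is a classical quadratic Koszul algebra: it is a quadratic algebra (generated in degree $1$, with relations generated in degree $2$), and the trivial left module $K=M_q(n)/M_q(n)_{\ge 1}$ has a linear graded free resolution $\cdots\to P_2\to P_1\to P_0\to K\to 0$, with $P_i$ a graded free module generated in degree $i$. -/

import Mathlib

open scoped PowerSeries

universe u

noncomputable section

/-- The defining relations of the standard quantized matrix algebra, in the free algebra on the
letters `Z (i, j)`, with `i j : Fin n` (indices start at `0`). -/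
inductive QuantumMatrixRel {K : Type u} [Field K] (n : ℕ) (q : K) :
    FreeAlgebra K (Fin n × Fin n) → FreeAlgebra K (Fin n × Fin n) → Prop
  | row (i j k : Fin n) (hjk : j < k) : QuantumMatrixRel n q
      (FreeAlgebra.ι K (i, j) * FreeAlgebra.ι K (i, k))
      (q • (FreeAlgebra.ι K (i, k) * FreeAlgebra.ι K (i, j)))
  | col (i k j : Fin n) (hik : i < k) : QuantumMatrixRel n q
      (FreeAlgebra.ι K (i, j) * FreeAlgebra.ι K (k, j))
      (q • (FreeAlgebra.ι K (k, j) * FreeAlgebra.ι K (i, j)))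
  | anti (i j s t : Fin n) (his : i < s) (htj : t < j) : QuantumMatrixRel n q
      (FreeAlgebra.ι K (i, j) * FreeAlgebra.ι K (s, t))
      (FreeAlgebra.ι K (s, t) * FreeAlgebra.ι K (i, j))
  | diag (i j s t : Fin n) (his : i < s) (hjt : j < t) : QuantumMatrixRel n q
      (FreeAlgebra.ι K (i, j) * FreeAlgebra.ι K (s, t))
      (FreeAlgebra.ι K (s, t) * FreeAlgebra.ι K (i, j)
        + (q - q⁻¹) • (FreeAlgebra.ι K (i, t) * FreeAlgebra.ι K (s, j)))

/-- The standard quantized matrix algebra `M_q(n)`: the free algebra modulo the two-sided ideal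
generated by the defining relations. -/
abbrev QuantumMatrixAlgebra {K : Type u} [Field K] (n : ℕ) (q : K) : Type u :=
  RingQuot (QuantumMatrixRel n q)

namespace QuantumMatrixAlgebra

/-- The generator `z_{ij}` of `M_q(n)`. -/
def z {K : Type u} [Field K] (n : ℕ) (q : K) (p : Fin n × Fin n) : QuantumMatrixAlgebra n q :=
  RingQuot.mkAlgHom K (QuantumMatrixRel n q) (FreeAlgebra.ι K p)

/-- The standard `ℕ`-gradation in which each `z_{ij}` has degree one: the degree `d` component is
the `d`-th power of the span of the generators, that is, the span of all words of length `d` in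
the generators. -/
def grading {K : Type u} [Field K] (n : ℕ) (q : K) (d : ℕ) :
    Submodule K (QuantumMatrixAlgebra n q) :=
  Submodule.span K (Set.range (z n q)) ^ d

end QuantumMatrixAlgebra

section GeneralNotions

/-- `A = ⨁ 𝒜 d` is an `ℕ`-graded algebra, all components are finite-dimensional, and
`𝒜 0 = K · 1` is one-dimensional. -/
structure IsConnectedGradedAlgebra {K A : Type u} [Field K] [Ring A] [Algebra K A]
    (𝒜 : ℕ → Submodule K A) : Prop where
  nontrivial : Nontrivial A
  gradedMonoid : SetLike.GradedMonoid 𝒜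
  isInternal : DirectSum.IsInternal 𝒜
  degree_zero : 𝒜 0 = 1
  finite : ∀ d, Module.Finite K (𝒜 d)

/-- The Hilbert series `∑ (dim 𝒜 d) t ^ d`, as a formal power series over `ℚ`. -/
def hilbertSeries {K A : Type u} [Field K] [Ring A] [Algebra K A]
    (𝒜 : ℕ → Submodule K A) : ℚ⟦X⟧ :=
  PowerSeries.mk fun d => (Module.finrank K (𝒜 d) : ℚ)

/-- The Gelfand–Kirillov dimension: the supremum over all finite-dimensional subspaces `V` of
`limsup_m log_m dim (K + V + V ^ 2 + ⋯ + V ^ m)`. The subspace `(1 ⊔ V) ^ m` is that sum. -/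
def gelfandKirillovDimension (K A : Type u) [Field K] [Ring A] [Algebra K A] : EReal :=
  ⨆ (V : Submodule K A) (_ : Module.Finite K V),
    Filter.limsup
      (fun m : ℕ =>
        ((Real.log (Module.finrank K ((1 ⊔ V) ^ m : Submodule K A) : ℝ) / Real.log (m : ℝ) : ℝ) :
          EReal))
      Filter.atTop

/-- The (left) global homological dimension: the supremum of the projective dimensions of all
left modules. The right global dimension of `A` is `globalDimension Aᵐᵒᵖ`. -/
def globalDimension (A : Type u) [Ring A] : WithBot ℕ∞ :=
  ⨆ M : ModuleCat.{u} A, CategoryTheory.projectiveDimension M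

/-- A quadratic algebra: generated in degree one, with all relations among elements of degree one
generated, as a two-sided ideal of the tensor algebra, by those of degree two. -/
structure IsQuadraticAlgebra {K A : Type u} [Field K] [Ring A] [Algebra K A]
    (𝒜 : ℕ → Submodule K A) : Prop where
  connected : IsConnectedGradedAlgebra 𝒜
  generated : Function.Surjective (TensorAlgebra.lift K (𝒜 1).subtype)
  relations : TwoSidedIdeal.ker (TensorAlgebra.lift K (𝒜 1).subtype) =
    TwoSidedIdeal.span
      {x | x ∈ LinearMap.range (TensorAlgebra.ι K (M := 𝒜 1)) ^ 2 ∧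
        TensorAlgebra.lift K (𝒜 1).subtype x = 0}

/-- The left ideal `A₊` generated by the homogeneous elements of positive degree. -/
def augmentationIdeal {K A : Type u} [Field K] [Ring A] [Algebra K A]
    (𝒜 : ℕ → Submodule K A) : Submodule A A :=
  Submodule.span A {a | ∃ d : ℕ, 1 ≤ d ∧ a ∈ 𝒜 d}

/-- A linear free resolution `⋯ → P₂ → P₁ → P₀ → A / A₊ → 0` of the trivial left module:
`P i` is the free module on the basis `ι i`, placed in degree `i`. That the maps are homogeneous of
degree zero means that `d i` sends a basis vector of `P (i + 1)` to a combination of basis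
vectors of `P i` with coefficients in `𝒜 1`, and that `ε` sends a basis vector of `P 0` into the
degree zero part of `A / A₊`. -/
structure LinearFreeResolution {K A : Type u} [Field K] [Ring A] [Algebra K A]
    (𝒜 : ℕ → Submodule K A) where
  /-- The basis of the `i`-th free module. -/
  ι : ℕ → Type u
  /-- The differentials. -/
  d : ∀ i, (ι (i + 1) →₀ A) →ₗ[A] (ι i →₀ A)
  /-- The augmentation. -/
  ε : (ι 0 →₀ A) →ₗ[A] (A ⧸ augmentationIdeal 𝒜)
  d_linear : ∀ i k l, d i (Finsupp.single k 1) l ∈ 𝒜 1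
  ε_degree_zero : ∀ k, ∃ a ∈ 𝒜 0, ε (Finsupp.single k 1) = (augmentationIdeal 𝒜).mkQ a
  exact_succ : ∀ i, Function.Exact (d (i + 1)) (d i)
  exact_zero : Function.Exact (d 0) ε
  surjective : Function.Surjective ε

/-- A classical quadratic Koszul algebra: a quadratic algebra whose trivial module has a linear
free resolution. -/
structure IsClassicalKoszulAlgebra {K A : Type u} [Field K] [Ring A] [Algebra K A]
    (𝒜 : ℕ → Submodule K A) : Prop where
  quadratic : IsQuadraticAlgebra 𝒜
  koszul : Nonempty (LinearFreeResolution 𝒜)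

end GeneralNotions

end

noncomputable section

/-! Everything follows from one structural fact: `M_q(n)` is an iterated Ore extension in its `N = n
^ 2` generators, taken in lexicographic order, with quadratic homogeneous relations.
`IsQuadraticSkewPBW` isolates what is needed. Moving `x k` leftwards past an earlier `x i` costs a
scalar `c`, realised by an endomorphism `σ` of the whole algebra, and a quadratic term in letters
before `k`; the ordered monomials are independent; there are a degree map and an augmentation.

The ordered monomials then form a homogeneous basis. Counting them by total degree gives the Hilbert
series, and comparing the degree filtration with boxes of exponents gives the Gelfand–Kirillov
dimension.

Write `A_k` for the subalgebra on the first `k` generators. For every `A`-module `M` there is an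
exact sequence `0 → A ⊗_{A_k} M^σ → A ⊗_{A_k} M → A ⊗_{A_{k+1}} M → 0`. The module `A ⊗_{A_0} M` is
free and `A ⊗_{A_N} M = M`, so induction on `k` bounds projective dimensions by `N`. That `σ` acts
on all of `A` makes `M^σ` an `A`-module again, so the induction may range over all modules.

For `M = K` the same injectivity says that right multiplication by `x k` is injective on `A / (x 0,
…, x (k - 1))`. Iterated mapping cones therefore give a linear free resolution of `K` of length
exactly `N`. This is Koszulity. Its last differential has entries killed by the augmentation, so it
cannot split, and the global dimension is at least `N`. An anti-automorphism transfers the result to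
the right side.

For `M_q(n)` the essential point is independence of the ordered monomials (`exists_upper_coord`).
Letters are adjoined from the last to the first; each new letter acts on skew polynomials over the
previous algebra. That this is possible comes down to `skewDerivation_rel`: the skew derivation
attached to the letter respects the relations among the later ones. -/

/-- The decreasing ordered monomial `x_{m-1} ^ a_{m-1} * ⋯ * x_0 ^ a_0`. -/
def orderedMonomial {A : Type*} [Monoid A] (x : ℕ → A) : ℕ → (ℕ → ℕ) → A
  | 0, _ => 1
  | m + 1, a => x m ^ a m * orderedMonomial x m a

/-- An algebra generated by `x 0, …, x (N - 1)`, with homogeneous quadratic straightening relations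
of skew-polynomial type, in which the ordered monomials are linearly independent. -/
structure IsQuadraticSkewPBW (K : Type*) {A : Type*} [Field K] [Ring A] [Algebra K A]
    (x : ℕ → A) (N : ℕ) : Prop where
  adjoin_eq_top : Algebra.adjoin K (x '' Set.Iio N) = ⊤
  twist : ∀ k < N, ∃ σ : A →ₐ[K] A, ∀ i < k, ∃ c r : K, ∃ a b : ℕ, a < k ∧ b < k ∧
    σ (x i) = c • x i ∧ x i * x k = c • (x k * x i) + r • (x a * x b)
  coord : ∃ φ : A →ₗ[K] ((ℕ → ℕ) →₀ K), ∀ a : ℕ → ℕ, (∀ i, N ≤ i → a i = 0) →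
    φ (orderedMonomial x N a) = Finsupp.single a 1
  degree : ∃ ψ : A →ₐ[K] Polynomial A, ∀ i < N, ψ (x i) = Polynomial.monomial 1 (x i)
  augmentation : ∃ ε : A →ₐ[K] K, ∀ i < N, ε (x i) = 0

/-! ### Ordered monomials and their splitting at a position `k`. -/

section OrderedMonomial

variable {A : Type*} [Monoid A] (x : ℕ → A)

theorem orderedMonomial_congr {m : ℕ} {a b : ℕ → ℕ} (h : ∀ i < m, a i = b i) :
    orderedMonomial x m a = orderedMonomial x m b := by
  induction m with
  | zero => rfl
  | succ m ih =>
    rw [orderedMonomial, orderedMonomial, h m m.lt_succ_self, ih fun i hi => h i (hi.trans m.lt_succ_self)]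

theorem orderedMonomial_zero (m : ℕ) : orderedMonomial x m 0 = 1 := by
  induction m with
  | zero => rfl
  | succ m ih => simp [orderedMonomial, ih]

/-- The part of an exponent vector supported on indices at least `k`. -/
def upperPart (k : ℕ) (a : ℕ → ℕ) : ℕ → ℕ := fun i => if k ≤ i then a i else 0

theorem upperPart_of_le {k i : ℕ} (a : ℕ → ℕ) (h : k ≤ i) : upperPart k a i = a i := if_pos h

theorem upperPart_of_lt {k i : ℕ} (a : ℕ → ℕ) (h : i < k) : upperPart k a i = 0 :=
  if_neg (not_le.2 h)

theorem orderedMonomial_split {k m : ℕ} (hkm : k ≤ m) (a : ℕ → ℕ) :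
    orderedMonomial x m a = orderedMonomial x m (upperPart k a) * orderedMonomial x k a := by
  induction m, hkm using Nat.le_induction with
  | base =>
    rw [orderedMonomial_congr x (b := 0) fun i hi => upperPart_of_lt a hi, orderedMonomial_zero,
      one_mul]
  | succ m hm ih => rw [orderedMonomial, orderedMonomial, upperPart_of_le a hm, ih, mul_assoc]

theorem orderedMonomial_mul {k m : ℕ} (hkm : k < m) {a : ℕ → ℕ} (ha : ∀ i < k, a i = 0) :
    orderedMonomial x m a * x k = orderedMonomial x m (a + Pi.single k 1) := by
  induction m, hkm using Nat.le_induction with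
  | base =>
    have h1 : orderedMonomial x k a = 1 := by
      rw [orderedMonomial_congr x (b := 0) ha, orderedMonomial_zero]
    have h2 : orderedMonomial x k (a + Pi.single k 1) = 1 := by
      rw [orderedMonomial_congr x (b := 0) fun i hi => by simp [ha i hi, hi.ne],
        orderedMonomial_zero]
    simp [orderedMonomial, h1, h2, pow_succ]
  | succ m hm ih =>
    have : m ≠ k := by omega
    simp [orderedMonomial, mul_assoc, ih, this]

end OrderedMonomial

/-! ### Ordered monomials span. -/

section Span

variable {K A : Type*} [Field K] [Ring A] [Algebra K A]

theorem adjoin_le_of_mul_mem {S : Set A} {W : Submodule K A} (h1 : 1 ∈ W)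
    (hS : ∀ s ∈ S, ∀ w ∈ W, w * s ∈ W) {a : A} (ha : a ∈ Algebra.adjoin K S) : a ∈ W := by
  suffices ∀ w ∈ W, w * a ∈ W by simpa using this 1 h1
  induction ha using Algebra.adjoin_induction with
  | mem s hs => exact hS s hs
  | algebraMap r =>
    intro w hw
    rw [← Algebra.commutes, ← Algebra.smul_def]
    exact W.smul_mem r hw
  | add a b _ _ iha ihb => exact fun w hw => mul_add w a b ▸ W.add_mem (iha w hw) (ihb w hw)
  | mul a b _ _ iha ihb => exact fun w hw => mul_assoc w a b ▸ ihb _ (iha w hw)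

/-- The subalgebra generated by the first `k` generators. -/
abbrev initialSubalgebra (K : Type*) {A : Type*} [Field K] [Ring A] [Algebra K A] (x : ℕ → A)
    (k : ℕ) : Subalgebra K A :=
  Algebra.adjoin K (x '' Set.Iio k)

theorem mem_initialSubalgebra {x : ℕ → A} {i k : ℕ} (h : i < k) : x i ∈ initialSubalgebra K x k :=
  Algebra.subset_adjoin ⟨i, h, rfl⟩

theorem orderedMonomial_mem (x : ℕ → A) (k : ℕ) (a : ℕ → ℕ) :
    orderedMonomial x k a ∈ initialSubalgebra K x k := by
  induction k with
  | zero => exact one_mem _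
  | succ k ih =>
    exact mul_mem (pow_mem (mem_initialSubalgebra k.lt_succ_self) _)
      (Algebra.adjoin_mono (Set.image_mono (Set.Iio_subset_Iio k.le_succ)) ih)

variable {x : ℕ → A} {N : ℕ}

/-- This is the Ore condition `A_k x_k ⊆ x_k A_k + A_k`. It holds on generators because the
correction term only uses letters before `k`, and it passes to products by moving `x k` across one
factor at a time. -/
theorem IsQuadraticSkewPBW.exists_mul_eq (hx : IsQuadraticSkewPBW K x N) {k : ℕ} (hk : k < N) {m : A}
    (hm : m ∈ initialSubalgebra K x k) :
    ∃ m₁ ∈ initialSubalgebra K x k, ∃ m₂ ∈ initialSubalgebra K x k, m * x k = x k * m₁ + m₂ := by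
  obtain ⟨σ, hσ⟩ := hx.twist k hk
  induction hm using Algebra.adjoin_induction with
  | mem s hs =>
    obtain ⟨i, hi, rfl⟩ := hs
    obtain ⟨c, r, a, b, ha, hb, -, h⟩ := hσ i hi
    exact ⟨c • x i, Subalgebra.smul_mem _ (mem_initialSubalgebra hi) c, r • (x a * x b),
      Subalgebra.smul_mem _ (mul_mem (mem_initialSubalgebra ha) (mem_initialSubalgebra hb)) r,
      by rw [h, mul_smul_comm]⟩
  | algebraMap r =>
    exact ⟨_, Subalgebra.algebraMap_mem _ r, 0, zero_mem _, by rw [add_zero, Algebra.commutes]⟩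
  | add a b _ _ iha ihb =>
    obtain ⟨a₁, ha₁, a₂, ha₂, ha⟩ := iha
    obtain ⟨b₁, hb₁, b₂, hb₂, hb⟩ := ihb
    exact ⟨_, add_mem ha₁ hb₁, _, add_mem ha₂ hb₂, by rw [add_mul, ha, hb, mul_add]; abel⟩
  | mul a b ha' _ iha ihb =>
    obtain ⟨a₁, ha₁, a₂, ha₂, ha⟩ := iha
    obtain ⟨b₁, hb₁, b₂, hb₂, hb⟩ := ihb
    refine ⟨_, mul_mem ha₁ hb₁, _, add_mem (mul_mem ha₂ hb₁) (mul_mem ha' hb₂),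
      ?_⟩
    rw [mul_assoc, hb, mul_add, ← mul_assoc, ha, add_mul, mul_assoc, add_assoc]

theorem one_mem_span_orderedMonomial (x : ℕ → A) (k : ℕ) :
    1 ∈ Submodule.span K (Set.range (orderedMonomial x k)) :=
  Submodule.subset_span ⟨0, orderedMonomial_zero x k⟩

/-- Sums of terms `x k ^ j * m` with `m ∈ A_k` are stable under right multiplication by letters of
`A_{k+1}`: an earlier letter is absorbed into `m`, and `x k` is carried left by the Ore condition.
-/
theorem IsQuadraticSkewPBW.mem_span (hx : IsQuadraticSkewPBW K x N) {k : ℕ} (hk : k ≤ N) {m : A}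
    (hm : m ∈ initialSubalgebra K x k) :
    m ∈ Submodule.span K (Set.range (orderedMonomial x k)) := by
  induction k generalizing m with
  | zero =>
    refine adjoin_le_of_mul_mem (one_mem_span_orderedMonomial x 0) (fun s hs => ?_) hm
    simp at hs
  | succ k ih =>
    have key : ∀ (j : ℕ) (m : A), m ∈ initialSubalgebra K x k →
        x k ^ j * m ∈ Submodule.span K (Set.range (orderedMonomial x (k + 1))) := by
      intro j m hm
      replace hm := ih (by omega) hm
      induction hm using Submodule.span_induction with
      | mem m hm =>
        obtain ⟨a, rfl⟩ := hm
        refine Submodule.subset_span ⟨Function.update a k j, ?_⟩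
        rw [orderedMonomial, Function.update_self,
          orderedMonomial_congr x fun i hi => Function.update_of_ne hi.ne _ _]
      | zero => simp
      | add a b _ _ ha hb => rw [mul_add]; exact add_mem ha hb
      | smul r a _ ha => rw [mul_smul_comm]; exact Submodule.smul_mem _ r ha
    refine adjoin_le_of_mul_mem (one_mem_span_orderedMonomial x _) ?_ hm
    rintro _ ⟨i, hi, rfl⟩ w hw
    induction hw using Submodule.span_induction with
    | mem m hm =>
      obtain ⟨a, rfl⟩ := hm
      rw [orderedMonomial, mul_assoc]
      have hma := orderedMonomial_mem (K := K) x k a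
      rcases (Nat.lt_succ_iff_lt_or_eq.1 hi) with hi | rfl
      · exact key _ _ (mul_mem hma (mem_initialSubalgebra hi))
      · obtain ⟨m₁, h₁, m₂, h₂, h⟩ := hx.exists_mul_eq (k := i) (by omega) hma
        rw [h, mul_add, ← mul_assoc, ← pow_succ]
        exact add_mem (key _ _ h₁) (key _ _ h₂)
    | zero => simp
    | add a b _ _ ha hb => rw [add_mul]; exact add_mem ha hb
    | smul r a _ ha => rw [smul_mul_assoc]; exact Submodule.smul_mem _ r ha

/-- Exponent vectors supported on indices below `N`. -/
def exponents (N : ℕ) : Set (ℕ → ℕ) := {a | ∀ i, N ≤ i → a i = 0}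

theorem IsQuadraticSkewPBW.induction (hx : IsQuadraticSkewPBW K x N) {P : A → Prop}
    (hmon : ∀ a ∈ exponents N, P (orderedMonomial x N a)) (hadd : ∀ a b, P a → P b → P (a + b))
    (hsmul : ∀ (r : K) a, P a → P (r • a)) (a : A) : P a := by
  have h : a ∈ Submodule.span K (Set.range (orderedMonomial x N)) :=
    hx.mem_span le_rfl (by rw [initialSubalgebra, hx.adjoin_eq_top]; exact Algebra.mem_top)
  have hmon' : ∀ a, P (orderedMonomial x N a) := fun a => by
    rw [orderedMonomial_congr x (b := fun i => if i < N then a i else 0)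
      fun i hi => by simp [hi]]
    exact hmon _ fun i hi => by simp [hi.not_gt]
  induction h using Submodule.span_induction with
  | mem m hm => obtain ⟨a, rfl⟩ := hm; exact hmon' a
  | zero => simpa using hsmul 0 _ (hmon' 0)
  | add a b _ _ ha hb => exact hadd a b ha hb
  | smul r a _ ha => exact hsmul r a ha

/-- The coordinates with respect to the basis of ordered monomials. -/
def IsQuadraticSkewPBW.repr (hx : IsQuadraticSkewPBW K x N) : A →ₗ[K] ((ℕ → ℕ) →₀ K) :=
  hx.coord.choose

theorem IsQuadraticSkewPBW.repr_monomial (hx : IsQuadraticSkewPBW K x N) {a : ℕ → ℕ}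
    (ha : a ∈ exponents N) : hx.repr (orderedMonomial x N a) = Finsupp.single a 1 :=
  hx.coord.choose_spec a ha

end Span

open scoped TensorProduct
open CategoryTheory

theorem moduleCat_shortExact {R : Type u} [Ring R] {X Y Z : Type u} [AddCommGroup X]
    [AddCommGroup Y] [AddCommGroup Z] [Module R X] [Module R Y] [Module R Z] {f : X →ₗ[R] Y}
    {g : Y →ₗ[R] Z} (hf : Function.Injective f) (hfg : Function.Exact f g)
    (hg : Function.Surjective g) :
    (ShortComplex.mk (ModuleCat.ofHom f) (ModuleCat.ofHom g)
      (by ext y; exact hfg.apply_apply_eq_zero y)).ShortExact where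
  exact := (ShortComplex.ShortExact.moduleCat_exact_iff_function_exact _).2 hfg
  mono_f := (ModuleCat.mono_iff_injective _).2 hf
  epi_g := (ModuleCat.epi_iff_surjective _).2 hg

/-! ### The induced modules `A ⊗_{A_k} M` and the exact sequence linking consecutive ones. -/

section Induced

variable {K A : Type*} [Field K] [Ring A] [Algebra K A] {M : Type*} [AddCommGroup M] [Module K M]

/-- The relations presenting the module induced from the subalgebra generated by the first `k`
generators: the quotient of `A ⊗ M` by them is `A ⊗_{A_k} M`. -/
def inducedRel (x : ℕ → A) (k : ℕ) (ρ : A →ₐ[K] Module.End K M) : Submodule A (A ⊗[K] M) :=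
  Submodule.span A {t | ∃ i < k, ∃ m, t = x i ⊗ₜ m - 1 ⊗ₜ ρ (x i) m}

variable {x : ℕ → A} {N k : ℕ} {ρ : A →ₐ[K] Module.End K M}

theorem inducedRel_mono {k l : ℕ} (h : k ≤ l) : inducedRel x k ρ ≤ inducedRel x l ρ :=
  Submodule.span_mono fun _ ⟨i, hi, hm⟩ => ⟨i, hi.trans_le h, hm⟩

/-- The relations are imposed only for generators of `A_k`; moving the factors of a product across
the tensor sign one by one extends them to all of `A_k`. -/
theorem mul_tmul_sub_mem {y : A} (hy : y ∈ initialSubalgebra K x k) (a : A) (m : M) :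
    (a * y) ⊗ₜ m - a ⊗ₜ ρ y m ∈ inducedRel x k ρ := by
  induction hy using Algebra.adjoin_induction generalizing a m with
  | mem s hs =>
    obtain ⟨i, hi, rfl⟩ := hs
    have := (inducedRel x k ρ).smul_mem a (Submodule.subset_span ⟨i, hi, m, rfl⟩)
    simpa [smul_sub, TensorProduct.smul_tmul'] using this
  | algebraMap r =>
    rw [← Algebra.commutes, ← Algebra.smul_def, AlgHom.commutes, Module.algebraMap_end_apply,
      TensorProduct.smul_tmul, sub_self]
    exact zero_mem _
  | add y z _ _ ihy ihz =>
    convert add_mem (ihy a m) (ihz a m) using 1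
    simp only [mul_add, TensorProduct.add_tmul, map_add, LinearMap.add_apply,
      TensorProduct.tmul_add]
    abel
  | mul y z _ _ ihy ihz =>
    convert add_mem (ihz (a * y) m) (ihy a (ρ z m)) using 1
    simp [mul_assoc]

variable (x) in
/-- Right multiplication by `x k` minus the action of `x k`. -/
def inducedMap (k : ℕ) (ρ : A →ₐ[K] Module.End K M) : A ⊗[K] M →ₗ[A] A ⊗[K] M :=
  TensorProduct.AlgebraTensorModule.map (LinearMap.toSpanSingleton A A (x k)) LinearMap.id -
    TensorProduct.AlgebraTensorModule.map LinearMap.id (ρ (x k))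

theorem inducedMap_tmul (k : ℕ) (ρ : A →ₐ[K] Module.End K M) (a : A) (m : M) :
    inducedMap x k ρ (a ⊗ₜ m) = (a * x k) ⊗ₜ m - a ⊗ₜ ρ (x k) m := by
  simp [inducedMap]

/-- The twist by `σ` is what makes right multiplication by `x k` minus its action descend to the
quotients. In the image of a relation for `x i`, the straightening rule replaces `x i * x k` by `c •
x k * x i` plus an element of `A_k`, and the scalar `c` matches the one in `σ (x i)`. -/
theorem inducedMap_mem {k : ℕ} {σ : A →ₐ[K] A}
    (hσ : ∀ i < k, ∃ c r : K, ∃ a b : ℕ, a < k ∧ b < k ∧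
      σ (x i) = c • x i ∧ x i * x k = c • (x k * x i) + r • (x a * x b)) :
    inducedRel x k (ρ.comp σ) ≤ (inducedRel x k ρ).comap (inducedMap x k ρ) := by
  refine Submodule.span_le.2 ?_
  rintro _ ⟨i, hi, m, rfl⟩
  obtain ⟨c, r, a, b, ha, hb, hs, h⟩ := hσ i hi
  have hd : r • (x a * x b) ∈ initialSubalgebra K x k := Subalgebra.smul_mem _
    (mul_mem (mem_initialSubalgebra ha) (mem_initialSubalgebra hb)) r
  have hρ := congr(ρ $h)
  simp only [map_mul, map_add, map_smul] at hρ
  have h1 := mul_tmul_sub_mem (ρ := ρ) hd 1 m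
  have h2 := mul_tmul_sub_mem (ρ := ρ) (mem_initialSubalgebra (K := K) (x := x) hi) (x k) (c • m)
  have h3 := mul_tmul_sub_mem (ρ := ρ) (mem_initialSubalgebra (K := K) (x := x) hi) 1 (ρ (x k) m)
  have hρm := congr($hρ m)
  simp only [Module.End.mul_apply, LinearMap.add_apply, LinearMap.smul_apply] at hρm
  rw [SetLike.mem_coe, Submodule.mem_comap]
  convert sub_mem (add_mem h1 h2) h3 using 1
  simp only [map_sub, inducedMap_tmul, h, AlgHom.comp_apply, hs, map_smul, LinearMap.smul_apply,
    one_mul, TensorProduct.add_tmul, TensorProduct.smul_tmul, TensorProduct.tmul_smul,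
    map_mul, Module.End.mul_apply, hρm, TensorProduct.tmul_add, LinearMap.map_smul_of_tower,
    smul_sub]
  abel

/-- Hence the cokernel of the map induced on `A ⊗_{A_k} M` is `A ⊗_{A_{k+1}} M`. -/
theorem inducedRel_succ :
    inducedRel x (k + 1) ρ = inducedRel x k ρ ⊔ LinearMap.range (inducedMap x k ρ) := by
  apply le_antisymm
  · refine Submodule.span_le.2 ?_
    rintro _ ⟨i, hi, m, rfl⟩
    rcases Nat.lt_succ_iff_lt_or_eq.1 hi with hi | rfl
    · exact Submodule.mem_sup_left (Submodule.subset_span ⟨i, hi, m, rfl⟩)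
    · exact Submodule.mem_sup_right ⟨1 ⊗ₜ m, by rw [inducedMap_tmul, one_mul]⟩
  · refine sup_le (inducedRel_mono k.le_succ) ?_
    rintro _ ⟨t, rfl⟩
    induction t using TensorProduct.induction_on with
    | zero => simp
    | tmul a m =>
      rw [inducedMap_tmul]
      exact mul_tmul_sub_mem (mem_initialSubalgebra k.lt_succ_self) a m
    | add s t hs ht => rw [map_add]; exact add_mem hs ht

/-- The coordinates on `A ⊗_{A_k} M`, indexed by monomials in the generators from `k` on. -/
def IsQuadraticSkewPBW.inducedRepr (hx : IsQuadraticSkewPBW K x N) (k : ℕ)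
    (ρ : A →ₐ[K] Module.End K M) : A ⊗[K] M →ₗ[K] ((ℕ → ℕ) →₀ M) :=
  TensorProduct.lift
    ((Finsupp.linearCombination K fun a : ℕ → ℕ =>
      (Finsupp.lsingle (R := K) (upperPart k a)).comp (ρ (orderedMonomial x k a))).comp hx.repr)

variable (hx : IsQuadraticSkewPBW K x N)
include hx

theorem IsQuadraticSkewPBW.inducedRepr_monomial {a : ℕ → ℕ} (ha : a ∈ exponents N) (m : M) :
    hx.inducedRepr k ρ (orderedMonomial x N a ⊗ₜ m) =
      Finsupp.single (upperPart k a) (ρ (orderedMonomial x k a) m) := by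
  simp [IsQuadraticSkewPBW.inducedRepr, hx.repr_monomial ha]

/-- An element of `A_k` expands in ordered monomials of the first `k` letters, and each of these
concatenates with the upper monomial to an ordered monomial. No straightening across position `k` is
needed. -/
theorem IsQuadraticSkewPBW.inducedRepr_mul (hk : k ≤ N) {a : ℕ → ℕ} (ha : a ∈ exponents N) {y : A}
    (hy : y ∈ initialSubalgebra K x k) (m : M) :
    hx.inducedRepr k ρ ((orderedMonomial x N (upperPart k a) * y) ⊗ₜ m) =
      Finsupp.single (upperPart k a) (ρ y m) := by
  replace hy := hx.mem_span hk hy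
  induction hy using Submodule.span_induction with
  | mem y hy =>
    obtain ⟨b, rfl⟩ := hy
    let c : ℕ → ℕ := fun i => if k ≤ i then a i else b i
    have hcu : upperPart k c = upperPart k a := by
      ext i; by_cases h : k ≤ i <;> simp [upperPart, c, h]
    have hcl : orderedMonomial x k c = orderedMonomial x k b :=
      orderedMonomial_congr x fun i hi => if_neg (not_le.2 hi)
    have hc : c ∈ exponents N := fun i hi => by simp [c, hk.trans hi, ha i hi]
    rw [← hcu, ← hcl, ← orderedMonomial_split x hk, hx.inducedRepr_monomial hc]
  | zero => simp
  | add y z _ _ hy hz => simp [mul_add, TensorProduct.add_tmul, hy, hz]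
  | smul r y _ hy =>
    rw [mul_smul_comm, ← TensorProduct.smul_tmul', map_smul, hy, map_smul, LinearMap.smul_apply,
      Finsupp.smul_single]

theorem IsQuadraticSkewPBW.inducedRepr_mul_generator (hk : k ≤ N) {i : ℕ} (hi : i < k) (a : A)
    (m : M) : hx.inducedRepr k ρ ((a * x i) ⊗ₜ m) = hx.inducedRepr k ρ (a ⊗ₜ ρ (x i) m) := by
  induction a using hx.induction with
  | hmon a ha =>
    rw [hx.inducedRepr_monomial ha, orderedMonomial_split x hk, mul_assoc,
      hx.inducedRepr_mul hk ha (mul_mem (orderedMonomial_mem x k a) (mem_initialSubalgebra hi)),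
      map_mul, Module.End.mul_apply]
  | hadd a b ha hb => simp only [add_mul, TensorProduct.add_tmul, map_add, ha, hb]
  | hsmul r a ha => rw [smul_mul_assoc, ← TensorProduct.smul_tmul', ← TensorProduct.smul_tmul',
      map_smul, map_smul, ha]

theorem IsQuadraticSkewPBW.inducedRepr_eq_zero (hk : k ≤ N) {t : A ⊗[K] M}
    (ht : t ∈ inducedRel x k ρ) : hx.inducedRepr k ρ t = 0 := by
  -- The coordinates are only `K`-linear while the relations are spanned over `A`, so the claim is
  -- strengthened to all left multiples.
  suffices ∀ a : A, hx.inducedRepr k ρ (a • t) = 0 by simpa using this 1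
  induction ht using Submodule.span_induction with
  | mem t ht =>
    obtain ⟨i, hi, m, rfl⟩ := ht
    intro a
    rw [smul_sub, TensorProduct.smul_tmul', TensorProduct.smul_tmul', map_sub, smul_eq_mul,
      smul_eq_mul, mul_one, hx.inducedRepr_mul_generator hk hi, sub_self]
  | zero => simp
  | add s t _ _ hs ht => intro a; rw [smul_add, map_add, hs, ht, add_zero]
  | smul b t _ ht => intro a; rw [smul_smul]; exact ht _

omit hx in
variable (K M x N) in
/-- The section of `inducedRepr`. -/
def ofInducedRepr : ((ℕ → ℕ) →₀ M) →ₗ[K] A ⊗[K] M :=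
  Finsupp.lsum K fun a => TensorProduct.mk K A M (orderedMonomial x N a)

omit hx in
theorem ofInducedRepr_single (a : ℕ → ℕ) (m : M) :
    ofInducedRepr K M x N (Finsupp.single a m) = orderedMonomial x N a ⊗ₜ m := by
  simp [ofInducedRepr]

/-- Together with `inducedRepr_eq_zero`, this shows that the kernel of the coordinate map is exactly
the submodule of relations. -/
theorem IsQuadraticSkewPBW.sub_ofInducedRepr_mem (hk : k ≤ N) (t : A ⊗[K] M) :
    t - ofInducedRepr K M x N (hx.inducedRepr k ρ t) ∈ inducedRel x k ρ := by
  induction t using TensorProduct.induction_on with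
  | zero => simp
  | tmul a m =>
    induction a using hx.induction with
    | hmon a ha =>
      rw [hx.inducedRepr_monomial ha, ofInducedRepr_single, orderedMonomial_split x hk]
      exact mul_tmul_sub_mem (orderedMonomial_mem x k a) _ _
    | hadd a b ha hb =>
      rw [TensorProduct.add_tmul, map_add, map_add, add_sub_add_comm]
      exact add_mem ha hb
    | hsmul r a ha =>
      rw [← TensorProduct.smul_tmul', map_smul, map_smul]
      have := Submodule.smul_of_tower_mem (inducedRel x k ρ) r ha
      rwa [smul_sub] at this
  | add s t hs ht =>
    rw [map_add, map_add, add_sub_add_comm]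
    exact add_mem hs ht

theorem IsQuadraticSkewPBW.inducedRepr_mem_supported (t : A ⊗[K] M) :
    hx.inducedRepr k ρ t ∈
      Finsupp.supported M K {a | a ∈ exponents N ∧ ∀ i < k, a i = 0} := by
  induction t using TensorProduct.induction_on with
  | zero => simp
  | tmul a m =>
    induction a using hx.induction with
    | hmon a ha =>
      rw [hx.inducedRepr_monomial ha]
      refine Finsupp.single_mem_supported K _ ⟨fun i hi => ?_, fun i hi => upperPart_of_lt a hi⟩
      rw [upperPart]
      split_ifs
      exacts [ha i hi, rfl]
    | hadd a b ha hb => rw [TensorProduct.add_tmul, map_add]; exact add_mem ha hb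
    | hsmul r a ha =>
      rw [← TensorProduct.smul_tmul', map_smul]; exact Submodule.smul_mem _ r ha
  | add s t hs ht => rw [map_add]; exact add_mem hs ht

/-- In a monomial in the letters from `k` on, `x k` is the rightmost letter, so right multiplication
by it merely raises one exponent. In coordinates the map is a shift minus the action of `x k`. -/
theorem IsQuadraticSkewPBW.inducedRepr_inducedMap (hk : k < N) {f : (ℕ → ℕ) →₀ M}
    (hf : f ∈ Finsupp.supported M K {a | a ∈ exponents N ∧ ∀ i < k, a i = 0}) :
    hx.inducedRepr k ρ (inducedMap x k ρ (ofInducedRepr K M x N f)) =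
      f.mapDomain (· + Pi.single k 1) - f.mapRange (ρ (x k)) (map_zero _) := by
  induction f using Finsupp.induction with
  | zero => simp
  | single_add a m f haf hm ih =>
    rw [Finsupp.mem_supported'] at hf ih
    have ha : a ∈ {a | a ∈ exponents N ∧ ∀ i < k, a i = 0} := by
      by_contra h
      have := hf a h
      rw [Finsupp.add_apply, Finsupp.single_eq_same, Finsupp.notMem_support_iff.1 haf,
        add_zero] at this
      exact hm this
    specialize ih fun b hb => by
      have hab : a ≠ b := fun h => hb (h ▸ ha)
      simpa [Finsupp.single_eq_of_ne' hab] using hf b hb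
    have hua : upperPart k a = a := by
      ext i
      rcases lt_or_ge i k with h | h
      · rw [upperPart_of_lt a h, ha.2 i h]
      · exact upperPart_of_le a h
    have h1 : a + Pi.single k 1 ∈ exponents N := fun i hi => by
      simp [ha.1 i hi, (hk.trans_le hi).ne']
    have h2 : upperPart k (a + Pi.single k 1) = a + Pi.single k 1 := by
      ext i
      rcases lt_or_ge i k with h | h
      · simp [upperPart_of_lt _ h, ha.2 i h, h.ne]
      · exact upperPart_of_le _ h
    have h3 : ∀ b : ℕ → ℕ, (∀ i < k, b i = 0) → orderedMonomial x k b = 1 := fun b hb => by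
      rw [orderedMonomial_congr x (b := 0) hb, orderedMonomial_zero]
    have h4 : orderedMonomial x k (a + Pi.single k 1) = 1 :=
      h3 _ fun i hi => by simp [ha.2 i hi, hi.ne]
    rw [map_add, map_add, map_add, ih, ofInducedRepr_single, inducedMap_tmul,
      orderedMonomial_mul x hk ha.2, map_sub, hx.inducedRepr_monomial h1,
      hx.inducedRepr_monomial ha.1, h2, hua, h3 a ha.2, h4, map_one, Module.End.one_apply,
      Finsupp.mapDomain_add, Finsupp.mapDomain_single, Finsupp.mapRange_add (map_add _),
      Finsupp.mapRange_single, Module.End.one_apply]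
    abel

/-- `0 → A ⊗_{A_k} M^σ → A ⊗_{A_k} M` is exact. -/
theorem IsQuadraticSkewPBW.mem_of_inducedMap_mem (hk : k < N) {σ : A →ₐ[K] A}
    (hσ : ∀ i < k, ∃ c r : K, ∃ a b : ℕ, a < k ∧ b < k ∧
      σ (x i) = c • x i ∧ x i * x k = c • (x k * x i) + r • (x a * x b))
    {t : A ⊗[K] M} (ht : inducedMap x k ρ t ∈ inducedRel x k ρ) :
    t ∈ inducedRel x k (ρ.comp σ) := by
  let f := hx.inducedRepr k (ρ.comp σ) t
  have h1 := hx.sub_ofInducedRepr_mem (ρ := ρ.comp σ) hk.le t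
  suffices f = 0 by simpa [show hx.inducedRepr k (ρ.comp σ) t = 0 from this] using h1
  have h2 : inducedMap x k ρ (ofInducedRepr K M x N f) ∈ inducedRel x k ρ := by
    have := sub_mem ht (inducedMap_mem (ρ := ρ) hσ h1)
    rwa [map_sub, sub_sub_cancel] at this
  have h3 := hx.inducedRepr_eq_zero hk.le h2
  rw [hx.inducedRepr_inducedMap hk (f := f) (hx.inducedRepr_mem_supported t), sub_eq_zero] at h3
  by_contra hne
  -- Leading term argument: at a point of the support with largest `k`-th exponent, equality of the
  -- shift with the coefficientwise action forces a nonzero coefficient one step higher.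
  obtain ⟨a, ha, hmax⟩ := f.support.exists_max_image (fun a => a k) (Finsupp.support_nonempty_iff.2 hne)
  have h4 : f (a + Pi.single k 1) ≠ 0 := by
    intro h0
    have := congr($h3 (a + Pi.single k 1))
    rw [Finsupp.mapDomain_apply (f := fun b : ℕ → ℕ => b + Pi.single k 1)
      (add_left_injective (Pi.single k 1)),
      Finsupp.mapRange_apply, h0, map_zero] at this
    exact Finsupp.mem_support_iff.1 ha this
  have := hmax _ (Finsupp.mem_support_iff.2 h4)
  simp at this

end Induced

/-! ### Upper bound for the global dimension. -/

section GlobalDimension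

variable {K A : Type u} [Field K] [Ring A] [Algebra K A] {x : ℕ → A} {N : ℕ}

/-- Each step of the exact sequence raises the bound by one. The induction is over all actions `ρ`,
since the left-hand term carries the twisted action `ρ.comp σ`. -/
theorem IsQuadraticSkewPBW.hasProjectiveDimensionLT_induced (hx : IsQuadraticSkewPBW K x N)
    {k : ℕ} (hk : k ≤ N) {M : Type u} [AddCommGroup M] [Module K M] (ρ : A →ₐ[K] Module.End K M) :
    HasProjectiveDimensionLT (ModuleCat.of A ((A ⊗[K] M) ⧸ inducedRel x k ρ)) (k + 1) := by
  induction k generalizing ρ with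
  | zero =>
    have h0 : inducedRel x 0 ρ = ⊥ := by
      rw [inducedRel, Submodule.span_eq_bot]
      rintro _ ⟨i, hi, -⟩
      omega
    have : Module.Projective A ((A ⊗[K] M) ⧸ inducedRel x 0 ρ) :=
      Module.Projective.of_equiv (Submodule.quotEquivOfEqBot _ h0).symm
    have := (IsProjective.iff_projective (R := A) _).1 this
    rw [zero_add]
    infer_instance
  | succ k ih =>
    obtain ⟨σ, hσ⟩ := hx.twist k hk
    let f := (inducedRel x k (ρ.comp σ)).mapQ (inducedRel x k ρ) (inducedMap x k ρ)
      (inducedMap_mem hσ)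
    let g := Submodule.factor (inducedRel_mono (x := x) (ρ := ρ) k.le_succ)
    have hf : Function.Injective f := by
      rw [← LinearMap.ker_eq_bot, LinearMap.ker_eq_bot']
      intro t ht
      obtain ⟨t, rfl⟩ := Submodule.mkQ_surjective _ t
      rw [Submodule.mkQ_apply, Submodule.mapQ_apply, Submodule.Quotient.mk_eq_zero] at ht
      exact (Submodule.Quotient.mk_eq_zero _).2 (hx.mem_of_inducedMap_mem hk hσ ht)
    have hg : Function.Surjective g := Submodule.factor_surjective _
    have hfg : Function.Exact f g := by
      intro t
      obtain ⟨t, rfl⟩ := Submodule.mkQ_surjective _ t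
      change Submodule.Quotient.mk t = 0 ↔ Submodule.Quotient.mk t ∈ _
      rw [Submodule.Quotient.mk_eq_zero, inducedRel_succ, Submodule.mem_sup]
      constructor
      · rintro ⟨y, hy, _, ⟨s, rfl⟩, rfl⟩
        refine ⟨Submodule.Quotient.mk s, ?_⟩
        rw [Submodule.mapQ_apply, Submodule.Quotient.eq]
        simpa using hy
      · rintro ⟨s, hs⟩
        obtain ⟨s, rfl⟩ := Submodule.mkQ_surjective _ s
        rw [Submodule.mkQ_apply, Submodule.mapQ_apply, eq_comm, Submodule.Quotient.eq] at hs
        exact ⟨_, hs, _, ⟨s, rfl⟩, sub_add_cancel _ _⟩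
    exact (moduleCat_shortExact hf hfg hg).hasProjectiveDimensionLT_X₃ (k + 1)
      (ih (by omega) _)
      (have := ih (by omega) ρ; hasProjectiveDimensionLT_of_ge _ (k + 1) _ (by omega))

/-- At `k = N` the subalgebra is all of `A`, so the relations are the kernel of the action map `A ⊗
M → M` and the induced module is `M` itself. -/
theorem IsQuadraticSkewPBW.hasProjectiveDimensionLE (hx : IsQuadraticSkewPBW K x N)
    (M : ModuleCat.{u} A) : HasProjectiveDimensionLE M N := by
  let : Module K M := Module.compHom M (algebraMap K A)
  have : IsScalarTower K A M := ⟨fun r a m => by rw [Algebra.smul_def, mul_smul]; rfl⟩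
  let ρ : A →ₐ[K] Module.End K M := Algebra.lsmul K K M
  let μ : A ⊗[K] M →ₗ[A] M := TensorProduct.AlgebraTensorModule.lift
    (LinearMap.toSpanSingleton A (M →ₗ[K] M) LinearMap.id)
  have hμ : ∀ a m, μ (a ⊗ₜ m) = a • m := fun a m => by simp [μ]
  have hsub : ∀ t, t - 1 ⊗ₜ μ t ∈ inducedRel x N ρ := by
    intro t
    induction t using TensorProduct.induction_on with
    | zero => simp
    | tmul a m =>
      have ha : a ∈ initialSubalgebra K x N := by
        rw [initialSubalgebra, hx.adjoin_eq_top]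
        exact Algebra.mem_top
      rw [hμ]
      have := mul_tmul_sub_mem (ρ := ρ) ha 1 m
      rwa [one_mul] at this
    | add s t hs ht =>
      rw [map_add, TensorProduct.tmul_add, add_sub_add_comm]
      exact add_mem hs ht
  have hker : inducedRel x N ρ = LinearMap.ker μ := by
    apply le_antisymm
    · refine Submodule.span_le.2 ?_
      rintro _ ⟨i, -, m, rfl⟩
      rw [SetLike.mem_coe, LinearMap.mem_ker, map_sub, hμ, hμ, one_smul]
      exact sub_self _
    · intro t ht
      have := hsub t
      rwa [LinearMap.mem_ker.1 ht, TensorProduct.tmul_zero, sub_zero] at this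
  let e : ((A ⊗[K] M) ⧸ inducedRel x N ρ) ≃ₗ[A] M := (Submodule.quotEquivOfEq _ _ hker).trans
    (μ.quotKerEquivOfSurjective fun m => ⟨1 ⊗ₜ m, by rw [hμ, one_smul]⟩)
  have := hx.hasProjectiveDimensionLT_induced le_rfl ρ
  exact hasProjectiveDimensionLT_of_iso e.toModuleIso (N + 1)

theorem IsQuadraticSkewPBW.globalDimension_le (hx : IsQuadraticSkewPBW K x N) :
    globalDimension A ≤ N :=
  iSup_le fun M => (projectiveDimension_le_iff M N).2 (hx.hasProjectiveDimensionLE M)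

end GlobalDimension

open CategoryTheory

/-! ### Homogeneous components. -/

section Degree

variable {K A : Type*} [Field K] [Ring A] [Algebra K A] {x : ℕ → A} {N : ℕ}

/-- The span of the generators. -/
def generatorSpan (K : Type*) {A : Type*} [Field K] [Ring A] [Algebra K A] (x : ℕ → A) (N : ℕ) :
    Submodule K A :=
  Submodule.span K (x '' Set.Iio N)

theorem orderedMonomial_mem_pow {m : ℕ} (hm : m ≤ N) (a : ℕ → ℕ) :
    orderedMonomial x m a ∈ generatorSpan K x N ^ ∑ i ∈ Finset.range m, a i := by
  induction m with
  | zero => simpa [orderedMonomial] using ⟨1, map_one _⟩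
  | succ m ih =>
    rw [Finset.sum_range_succ, add_comm, pow_add]
    have hxm : x m ∈ generatorSpan K x N := Submodule.subset_span ⟨m, hm, rfl⟩
    exact Submodule.mul_mem_mul (Submodule.pow_mem_pow _ hxm _) (ih (by omega))

variable (hx : IsQuadraticSkewPBW K x N)
include hx

/-- The algebra map `a ↦ ∑ a_d X ^ d`, where `a_d` is the degree `d` component. -/
def IsQuadraticSkewPBW.gradingHom : A →ₐ[K] Polynomial A := hx.degree.choose

/-- The degree `d` component. -/
def IsQuadraticSkewPBW.component (d : ℕ) : A →ₗ[K] A :=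
  ((Polynomial.lcoeff A d).restrictScalars K).comp hx.gradingHom.toLinearMap

theorem IsQuadraticSkewPBW.component_apply (d : ℕ) (a : A) :
    hx.component d a = (hx.gradingHom a).coeff d := rfl

theorem IsQuadraticSkewPBW.gradingHom_of_mem {d : ℕ} {a : A} (ha : a ∈ generatorSpan K x N ^ d) :
    hx.gradingHom a = Polynomial.monomial d a := by
  induction ha using Submodule.pow_induction_on_left' with
  | algebraMap r =>
    rw [AlgHom.commutes, Polynomial.algebraMap_apply, Polynomial.monomial_zero_left]
  | add a b i _ _ ha hb => rw [map_add, map_add, ha, hb]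
  | mem_mul v hv i a _ ha =>
    have hv' : hx.gradingHom v = Polynomial.monomial 1 v := by
      induction hv using Submodule.span_induction with
      | mem v hv =>
        obtain ⟨i, hi, rfl⟩ := hv
        exact hx.degree.choose_spec i hi
      | zero => simp
      | add a b _ _ ha hb => rw [map_add, map_add, ha, hb]
      | smul r a _ ha => rw [map_smul, ha, Polynomial.smul_monomial]
    rw [map_mul, hv', ha, Polynomial.monomial_mul_monomial, add_comm]

theorem IsQuadraticSkewPBW.component_of_mem {d : ℕ} {a : A} (ha : a ∈ generatorSpan K x N ^ d) :
    hx.component d a = a := by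
  rw [hx.component_apply, hx.gradingHom_of_mem ha, Polynomial.coeff_monomial_same]

theorem IsQuadraticSkewPBW.component_of_mem_of_ne {d e : ℕ} {a : A}
    (ha : a ∈ generatorSpan K x N ^ d) (h : d ≠ e) : hx.component e a = 0 := by
  rw [hx.component_apply, hx.gradingHom_of_mem ha, Polynomial.coeff_monomial_of_ne _ h.symm]

theorem IsQuadraticSkewPBW.component_mul {d : ℕ} {v : A} (hv : v ∈ generatorSpan K x N) (a : A) :
    hx.component (d + 1) (a * v) = hx.component d a * v := by
  rw [← pow_one (generatorSpan K x N)] at hv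
  rw [hx.component_apply, map_mul, hx.gradingHom_of_mem hv, Polynomial.coeff_mul_monomial]
  rfl

theorem IsQuadraticSkewPBW.component_mem (d : ℕ) (a : A) :
    hx.component d a ∈ generatorSpan K x N ^ d := by
  induction a using hx.induction with
  | hmon a _ =>
    have ha := orderedMonomial_mem_pow (K := K) (x := x) (le_refl N) a
    by_cases h : ∑ i ∈ Finset.range N, a i = d
    · subst h
      rwa [hx.component_of_mem ha]
    · rw [hx.component_of_mem_of_ne ha h]
      exact zero_mem _
  | hadd a b ha hb => rw [map_add]; exact add_mem ha hb
  | hsmul r a ha => rw [map_smul]; exact Submodule.smul_mem _ r ha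

end Degree

/-! ### Regularity of `x k` modulo the earlier generators. -/

section MonomialIdeal

variable {K A : Type*} [Field K] [Ring A] [Algebra K A] {x : ℕ → A} {N k : ℕ}

/-- The left ideal generated by the first `k` generators. -/
def initialIdeal (x : ℕ → A) (k : ℕ) : Submodule A A := Submodule.span A (x '' Set.Iio k)

theorem initialIdeal_succ : initialIdeal x (k + 1) = initialIdeal x k ⊔ Submodule.span A {x k} := by
  rw [initialIdeal, initialIdeal, ← Submodule.span_union, ← Set.image_singleton, ← Set.image_union]
  congr 2
  ext i
  simp [le_iff_lt_or_eq]

/-- After straightening `x i * x k`, both terms end in a letter of index below `k`. -/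
theorem IsQuadraticSkewPBW.mul_mem_initialIdeal (hx : IsQuadraticSkewPBW K x N) (hk : k < N) {a : A}
    (ha : a ∈ initialIdeal x k) : a * x k ∈ initialIdeal x k := by
  obtain ⟨σ, hσ⟩ := hx.twist k hk
  have hmem : ∀ {i} (b : A), i < k → b * x i ∈ initialIdeal x k := fun b hi =>
    Submodule.smul_mem _ b (Submodule.subset_span ⟨_, hi, rfl⟩)
  induction ha using Submodule.span_induction with
  | mem a ha =>
    obtain ⟨i, hi, rfl⟩ := ha
    obtain ⟨c, r, a, b, -, hb, -, h⟩ := hσ i hi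
    rw [h, ← smul_mul_assoc, ← smul_mul_assoc]
    exact add_mem (hmem _ hi) (hmem _ hb)
  | zero => simp
  | add a b _ _ ha hb => rw [add_mul]; exact add_mem ha hb
  | smul b a _ ha => rw [smul_eq_mul, mul_assoc]; exact Submodule.smul_mem _ b ha

-- Injectivity of the induced map for the trivial module `K`: all generators act as zero, also after
-- twisting, so `A ⊗_{A_k} K` is `A / (x 0, …, x (k - 1))` and the map is right multiplication by `x
-- k`.
open scoped TensorProduct in
theorem IsQuadraticSkewPBW.mem_initialIdeal_of_mul_mem (hx : IsQuadraticSkewPBW K x N) (hk : k < N)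
    {a : A} (ha : a * x k ∈ initialIdeal x k) : a ∈ initialIdeal x k := by
  obtain ⟨ε, hε⟩ := hx.augmentation
  obtain ⟨σ, hσ⟩ := hx.twist k hk
  let ρ : A →ₐ[K] Module.End K K := (Algebra.lsmul K K K).comp ε
  have hρ : ∀ i < N, ρ (x i) = 0 := fun i hi => by simp [ρ, hε i hi]
  have hρσ : ∀ i < k, (ρ.comp σ) (x i) = 0 := fun i hi => by
    obtain ⟨c, r, a, b, -, -, hs, -⟩ := hσ i hi
    rw [AlgHom.comp_apply, hs, map_smul, hρ i (hi.trans hk), smul_zero]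
  let e := TensorProduct.AlgebraTensorModule.rid K A A
  have h1 : ∀ b ∈ initialIdeal x k, b ⊗ₜ[K] (1 : K) ∈ inducedRel x k ρ := by
    intro b hb
    induction hb using Submodule.span_induction with
    | mem b hb =>
      obtain ⟨i, hi, rfl⟩ := hb
      refine Submodule.subset_span ⟨i, hi, 1, ?_⟩
      rw [hρ i (lt_trans hi hk), LinearMap.zero_apply, TensorProduct.tmul_zero, sub_zero]
    | zero => simp
    | add a b _ _ ha hb => rw [TensorProduct.add_tmul]; exact add_mem ha hb
    | smul b a _ ha => exact Submodule.smul_mem _ b ha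
  have h2 : inducedMap x k ρ (a ⊗ₜ 1) ∈ inducedRel x k ρ := by
    rw [inducedMap_tmul, hρ k hk, LinearMap.zero_apply, TensorProduct.tmul_zero, sub_zero]
    exact h1 _ ha
  have h3 := hx.mem_of_inducedMap_mem hk hσ h2
  have h4 : inducedRel x k (ρ.comp σ) ≤ (initialIdeal x k).comap e.toLinearMap := by
    refine Submodule.span_le.2 ?_
    rintro _ ⟨i, hi, m, rfl⟩
    rw [hρσ i hi, LinearMap.zero_apply, TensorProduct.tmul_zero, sub_zero]
    simp only [Submodule.comap_coe, Set.mem_preimage, LinearEquiv.coe_coe, e,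
      TensorProduct.AlgebraTensorModule.rid_tmul]
    exact Submodule.smul_of_tower_mem _ m (Submodule.subset_span ⟨i, hi, rfl⟩)
  simpa [e] using h4 h3

end MonomialIdeal

/-! ### Linear resolutions of cyclic modules and lifting of right multiplications. -/

open CategoryTheory

/-- All matrix entries of a map between free modules lie in `V`. -/
def HasEntriesIn {K A : Type*} [Field K] [Ring A] [Algebra K A] {ι κ : Type*} (V : Submodule K A)
    (f : (ι →₀ A) →ₗ[A] (κ →₀ A)) : Prop :=
  ∀ k l, f (Finsupp.single k 1) l ∈ V

/-- A linear free resolution of `A ⧸ I` whose term in degree zero has rank one. -/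
structure CyclicLinearResolution {K A : Type u} [Field K] [Ring A] [Algebra K A]
    (V : Submodule K A) (I : Submodule A A) where
  ι : ℕ → Type u
  [unique : Unique (ι 0)]
  d : ∀ i, (ι (i + 1) →₀ A) →ₗ[A] (ι i →₀ A)
  d_mem : ∀ i, HasEntriesIn V (d i)
  exact_succ : ∀ i, Function.Exact (d (i + 1)) (d i)
  exact_zero : ∀ p, p ∈ LinearMap.range (d 0) ↔ p default ∈ I

section Lift

variable {K A : Type u} [Field K] [Ring A] [Algebra K A] {x : ℕ → A} {N : ℕ}

theorem HasEntriesIn.apply_mem {ι κ : Type*} {V W : Submodule K A}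
    {f : (ι →₀ A) →ₗ[A] (κ →₀ A)} (hf : HasEntriesIn V f) {p : ι →₀ A} (hp : ∀ k, p k ∈ W) (l : κ) :
    f p l ∈ W * V := by
  have : f p = p.sum fun k a => a • f (Finsupp.single k 1) := by
    conv_lhs => rw [← p.sum_single, Finsupp.sum, map_sum]
    refine Finset.sum_congr rfl fun k _ => ?_
    change f (Finsupp.single k (p k)) = p k • f (Finsupp.single k 1)
    rw [← map_smul, Finsupp.smul_single, smul_eq_mul, mul_one]
  rw [this, Finsupp.sum, Finsupp.finsetSum_apply]
  exact sum_mem fun k _ => Submodule.mul_mem_mul (hp k) (hf k l)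

variable (hx : IsQuadraticSkewPBW K x N)
include hx

theorem IsQuadraticSkewPBW.map_component {ι κ : Type*} {f : (ι →₀ A) →ₗ[A] (κ →₀ A)}
    (hf : HasEntriesIn (generatorSpan K x N) f) (d : ℕ) (p : ι →₀ A) (l : κ) :
    f (p.mapRange (hx.component d) (map_zero _)) l = hx.component (d + 1) (f p l) := by
  induction p using Finsupp.induction_linear with
  | zero => simp
  | add p q hp hq =>
    rw [Finsupp.mapRange_add (map_add _), map_add, map_add, Finsupp.add_apply, Finsupp.add_apply,
      map_add, hp, hq]
  | single k a =>
    have h : ∀ b : A, f (Finsupp.single k b) l = b * f (Finsupp.single k 1) l := fun b => by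
      rw [← smul_eq_mul b, ← Finsupp.smul_apply, ← map_smul, Finsupp.smul_single, smul_eq_mul,
        mul_one]
    rw [Finsupp.mapRange_single, h, h a, hx.component_mul (hf k l)]

/-- Any preimage of a basis vector's image may be replaced by its component of degree one: `d`
raises degree by exactly one and the target is homogeneous of degree two. -/
theorem IsQuadraticSkewPBW.exists_lift {ι κ τ : Type u} {d : (ι →₀ A) →ₗ[A] (κ →₀ A)}
    (hd : HasEntriesIn (generatorSpan K x N) d) {g : (τ →₀ A) →ₗ[A] (κ →₀ A)}
    (hg : HasEntriesIn (generatorSpan K x N ^ 2) g) (hgd : LinearMap.range g ≤ LinearMap.range d) :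
    ∃ f : (τ →₀ A) →ₗ[A] (ι →₀ A), HasEntriesIn (generatorSpan K x N) f ∧ d ∘ₗ f = g := by
  have : ∀ k : τ, ∃ y : ι →₀ A, (∀ l, y l ∈ generatorSpan K x N) ∧
      d y = g (Finsupp.single k 1) := by
    intro k
    obtain ⟨y, hy⟩ := hgd ⟨Finsupp.single k 1, rfl⟩
    refine ⟨y.mapRange (hx.component 1) (map_zero _), fun l => ?_, ?_⟩
    · rw [Finsupp.mapRange_apply, ← pow_one (generatorSpan K x N)]
      exact hx.component_mem 1 _
    · ext l
      rw [hx.map_component hd, hy, hx.component_of_mem (hg k l)]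
  choose y hyV hyd using this
  refine ⟨Finsupp.linearCombination A y, fun k l => ?_, ?_⟩
  · simpa using hyV k l
  · ext k : 2
    simp [hyd]

namespace CyclicLinearResolution

variable {I : Submodule A A}

/-- Right multiplication by an element `v` of degree one that preserves `I` lifts to the
resolution, by maps with entries of degree one. -/
theorem exists_chainMap (R : CyclicLinearResolution (generatorSpan K x N) I) {v : A}
    (hv : v ∈ generatorSpan K x N) (hI : ∀ a ∈ I, a * v ∈ I) :
    ∃ f : ∀ i, (R.ι i →₀ A) →ₗ[A] (R.ι i →₀ A),
      (∀ i, HasEntriesIn (generatorSpan K x N) (f i)) ∧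
      (∀ p, f 0 p (R.unique.default) = p (R.unique.default) * v) ∧
      ∀ i, R.d i ∘ₗ f (i + 1) = f i ∘ₗ R.d i := by
  have := R.unique
  -- The recursion carries the fact that the map preserves the image of `R.d i`, which is what makes
  -- the next lift possible.
  let S : ℕ → Type u := fun i => {f : (R.ι i →₀ A) →ₗ[A] (R.ι i →₀ A) //
    HasEntriesIn (generatorSpan K x N) f ∧
      ∀ p ∈ LinearMap.range (R.d i), f p ∈ LinearMap.range (R.d i)}
  have step : ∀ i (s : S i), ∃ t : S (i + 1), R.d i ∘ₗ t.1 = s.1 ∘ₗ R.d i := by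
    rintro i ⟨s, hs, hsd⟩
    obtain ⟨t, ht, htd⟩ := hx.exists_lift (R.d_mem i) (g := s ∘ₗ R.d i)
      (fun k l => by
        rw [pow_two]
        exact hs.apply_mem (fun m => R.d_mem i k m) l)
      (by
        rintro _ ⟨p, rfl⟩
        exact hsd _ ⟨p, rfl⟩)
    refine ⟨⟨t, ht, fun p hp => ?_⟩, htd⟩
    refine (R.exact_succ i _).1 ?_
    have h1 := congr($htd p)
    simp only [LinearMap.comp_apply] at h1
    rw [h1, (R.exact_succ i p).2 hp, map_zero]
  choose next hnext using step
  let f₀ : (R.ι 0 →₀ A) →ₗ[A] (R.ι 0 →₀ A) :=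
    Finsupp.mapRange.linearMap (LinearMap.toSpanSingleton A A v)
  have hf₀ : ∀ p l, f₀ p l = p l * v := fun p l => by simp [f₀]
  let s₀ : S 0 := ⟨f₀, fun k l => by
      rw [hf₀]
      obtain rfl : k = l := Subsingleton.elim _ _
      simpa using hv,
    fun p hp => by
      rw [R.exact_zero] at hp ⊢
      rw [hf₀]
      exact hI _ hp⟩
  let F : ∀ i, S i := fun i => Nat.rec s₀ next i
  exact ⟨fun i => (F i).1, fun i => (F i).2.1, fun p => hf₀ p _, fun i => hnext i (F i)⟩

end CyclicLinearResolution

end Lift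

/-! ### Mapping cones. -/

section Cone

variable {K A : Type u} [Field K] [Ring A] [Algebra K A] {V : Submodule K A} {I : Submodule A A}

/-- The index types of a mapping cone. -/
def coneIndex (ι : ℕ → Type u) : ℕ → Type u
  | 0 => ι 0
  | i + 1 => ι (i + 1) ⊕ ι i

/-- Splitting a free module on a disjoint union. -/
abbrev sumEquiv (A : Type u) [Ring A] (α β : Type u) : ((α ⊕ β) →₀ A) ≃ₗ[A] (α →₀ A) × (β →₀ A) :=
  Finsupp.sumFinsuppLEquivProdFinsupp A

/-- The differential of the mapping cone of an endomorphism of a complex of free modules. -/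
def coneDiff (ι : ℕ → Type u) (d : ∀ i, (ι (i + 1) →₀ A) →ₗ[A] (ι i →₀ A))
    (f : ∀ i, (ι i →₀ A) →ₗ[A] (ι i →₀ A)) :
    ∀ i, (coneIndex ι (i + 1) →₀ A) →ₗ[A] (coneIndex ι i →₀ A)
  | 0 => (d 0).coprod (f 0) ∘ₗ (sumEquiv A (ι 1) (ι 0)).toLinearMap
  | i + 1 => (sumEquiv A (ι (i + 1)) (ι i)).symm.toLinearMap ∘ₗ
      (((d (i + 1)).coprod (f (i + 1))).prod (-(d i ∘ₗ LinearMap.snd A _ _))) ∘ₗ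
        (sumEquiv A (ι (i + 2)) (ι (i + 1))).toLinearMap

theorem sumEquiv_single_inl {α β : Type u} (k : α) (a : A) :
    sumEquiv A α β (Finsupp.single (Sum.inl k) a) = (Finsupp.single k a, 0) := by
  classical
  ext l <;> simp [sumEquiv, Finsupp.single_apply]

theorem sumEquiv_single_inr {α β : Type u} (k : β) (a : A) :
    sumEquiv A α β (Finsupp.single (Sum.inr k) a) = (0, Finsupp.single k a) := by
  classical
  ext l <;> simp [sumEquiv, Finsupp.single_apply]

section

variable (ι : ℕ → Type u) (d : ∀ i, (ι (i + 1) →₀ A) →ₗ[A] (ι i →₀ A))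
  (f : ∀ i, (ι i →₀ A) →ₗ[A] (ι i →₀ A))

theorem coneDiff_zero (p : ι 1 →₀ A) (q : ι 0 →₀ A) :
    coneDiff ι d f 0 ((sumEquiv A (ι 1) (ι 0)).symm (p, q)) = d 0 p + f 0 q := by
  change (d 0).coprod (f 0) (sumEquiv A (ι 1) (ι 0) ((sumEquiv A (ι 1) (ι 0)).symm (p, q))) = _
  rw [LinearEquiv.apply_symm_apply, LinearMap.coprod_apply]

theorem coneDiff_succ (i : ℕ) (p : ι (i + 2) →₀ A) (q : ι (i + 1) →₀ A) :
    coneDiff ι d f (i + 1) ((sumEquiv A (ι (i + 2)) (ι (i + 1))).symm (p, q)) =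
      (sumEquiv A (ι (i + 1)) (ι i)).symm (d (i + 1) p + f (i + 1) q, -d i q) := by
  change (sumEquiv A (ι (i + 1)) (ι i)).symm
    ((((d (i + 1)).coprod (f (i + 1))).prod (-(d i ∘ₗ LinearMap.snd A _ _)))
      (sumEquiv A (ι (i + 2)) (ι (i + 1)) ((sumEquiv A (ι (i + 2)) (ι (i + 1))).symm (p, q)))) = _
  rw [LinearEquiv.apply_symm_apply]
  simp

theorem coneDiff_hasEntriesIn (hd : ∀ i, HasEntriesIn V (d i)) (hf : ∀ i, HasEntriesIn V (f i)) :
    ∀ i, HasEntriesIn V (coneDiff ι d f i)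
  | 0, Sum.inl k, l => by
    have h : coneDiff ι d f (0) (Finsupp.single (α := ι 1 ⊕ ι 0) (Sum.inl k) 1) = d 0 (Finsupp.single k 1) := by
      rw [← (LinearEquiv.symm_apply_eq _).2 (sumEquiv_single_inl k (1 : A)).symm, coneDiff_zero, map_zero, add_zero]
    exact congr($h l) ▸ hd 0 k l
  | 0, Sum.inr k, l => by
    have h : coneDiff ι d f (0) (Finsupp.single (α := ι 1 ⊕ ι 0) (Sum.inr k) 1) = f 0 (Finsupp.single k 1) := by
      rw [← (LinearEquiv.symm_apply_eq _).2 (sumEquiv_single_inr k (1 : A)).symm, coneDiff_zero, map_zero, zero_add]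
    exact congr($h l) ▸ hf 0 k l
  | i + 1, Sum.inl k, l => by
    have h : coneDiff ι d f (i + 1) (Finsupp.single (α := ι (i + 2) ⊕ ι (i + 1)) (Sum.inl k) 1) = 
        (sumEquiv A (ι (i + 1)) (ι i)).symm (d (i + 1) (Finsupp.single k 1), 0) := by
      rw [← (LinearEquiv.symm_apply_eq _).2 (sumEquiv_single_inl k (1 : A)).symm, coneDiff_succ, map_zero, map_zero, add_zero,
        neg_zero]
    refine congr($h l) ▸ ?_
    rcases l with l | l
    · exact hd (i + 1) k l
    · exact zero_mem _
  | i + 1, Sum.inr k, l => by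
    have h : coneDiff ι d f (i + 1) (Finsupp.single (α := ι (i + 2) ⊕ ι (i + 1)) (Sum.inr k) 1) = (sumEquiv A (ι (i + 1)) (ι i)).symm
        (f (i + 1) (Finsupp.single k 1), -d i (Finsupp.single k 1)) := by
      rw [← (LinearEquiv.symm_apply_eq _).2 (sumEquiv_single_inr k (1 : A)).symm, coneDiff_succ, map_zero, zero_add]
    refine congr($h l) ▸ ?_
    rcases l with l | l
    · exact hf (i + 1) k l
    · exact V.neg_mem (hd i k l)

end

/-- The mapping cone of right multiplication by `v` resolves `A ⧸ (I + A v)`. -/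
theorem CyclicLinearResolution.exists_cone (R : CyclicLinearResolution V I) {v : A}
    {f : ∀ i, (R.ι i →₀ A) →ₗ[A] (R.ι i →₀ A)} (hf : ∀ i, HasEntriesIn V (f i))
    (hf₀ : ∀ p, f 0 p (R.unique.default) = p (R.unique.default) * v)
    (hfd : ∀ i, R.d i ∘ₗ f (i + 1) = f i ∘ₗ R.d i) (hI : ∀ a, a * v ∈ I → a ∈ I) :
    ∃ S : CyclicLinearResolution V (I ⊔ Submodule.span A {v}), S.ι = coneIndex R.ι := by
  let huniq := R.unique
  have hdd : ∀ i p, R.d i (R.d (i + 1) p) = 0 := fun i p => (R.exact_succ i).apply_apply_eq_zero p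
  replace hfd : ∀ i p, R.d i (f (i + 1) p) = f i (R.d i p) := fun i p => congr($(hfd i) p)
  let uniq : Unique (coneIndex R.ι 0) := R.unique
  refine ⟨{ ι := coneIndex R.ι, unique := uniq, d := coneDiff R.ι R.d f,
            d_mem := coneDiff_hasEntriesIn _ _ _ R.d_mem hf,
            exact_succ := ?_, exact_zero := ?_ }, rfl⟩
  · have key : ∀ i (p : R.ι (i + 1) →₀ A) r, R.d i p + f i (R.d i r) = 0 →
        ∃ s, p = R.d (i + 1) s - f (i + 1) r := by
      intro i p r h
      rw [← hfd, ← map_add] at h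
      obtain ⟨s, hs⟩ := (R.exact_succ i _).1 h
      exact ⟨s, by rw [hs, add_sub_cancel_right]⟩
    rintro (_ | i) t
    · obtain ⟨⟨p, q⟩, rfl⟩ := (sumEquiv A (R.ι 1) (R.ι 0)).symm.surjective t
      rw [coneDiff_zero]
      constructor
      · intro h
        -- Only here is injectivity of right multiplication by `v` on `A ⧸ I` used; it kills the
        -- first homology of the cone.
        have hq : q ∈ LinearMap.range (R.d 0) := by
          refine (R.exact_zero q).2 (hI _ ?_)
          rw [← hf₀, ← R.exact_zero]
          exact ⟨-p, by rw [map_neg]; exact neg_eq_iff_add_eq_zero.2 h⟩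
        obtain ⟨r, rfl⟩ := hq
        obtain ⟨s, rfl⟩ := key 0 p r h
        refine ⟨(sumEquiv A (R.ι 2) (R.ι 1)).symm (s, -r), ?_⟩
        rw [coneDiff_succ, map_neg, map_neg, neg_neg, sub_eq_add_neg]
      · rintro ⟨t, ht⟩
        obtain ⟨⟨s, r⟩, rfl⟩ := (sumEquiv A (R.ι 2) (R.ι 1)).symm.surjective t
        rw [coneDiff_succ] at ht
        obtain ⟨rfl, rfl⟩ := Prod.ext_iff.1 ((sumEquiv A (R.ι 1) (R.ι 0)).symm.injective ht)
        simp only [map_add, map_neg, hdd, hfd, zero_add, add_neg_cancel]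
        rfl
    · obtain ⟨⟨p, q⟩, rfl⟩ := (sumEquiv A (R.ι (i + 2)) (R.ι (i + 1))).symm.surjective t
      rw [coneDiff_succ]
      constructor
      · intro h
        have h' := (LinearEquiv.map_eq_zero_iff (sumEquiv A (R.ι (i + 1)) (R.ι i)).symm).1 h
        obtain ⟨h1, h2⟩ := Prod.ext_iff.1 h'
        obtain ⟨r, rfl⟩ := (R.exact_succ i q).1 (neg_eq_zero.1 h2)
        obtain ⟨s, rfl⟩ := key (i + 1) p r h1
        refine ⟨(sumEquiv A (R.ι (i + 3)) (R.ι (i + 2))).symm (s, -r), ?_⟩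
        rw [coneDiff_succ, map_neg, map_neg, neg_neg, sub_eq_add_neg]
      · rintro ⟨t, ht⟩
        obtain ⟨⟨s, r⟩, rfl⟩ := (sumEquiv A (R.ι (i + 3)) (R.ι (i + 2))).symm.surjective t
        rw [coneDiff_succ] at ht
        obtain ⟨rfl, rfl⟩ := Prod.ext_iff.1
          ((sumEquiv A (R.ι (i + 2)) (R.ι (i + 1))).symm.injective ht)
        simp only [map_add, map_neg, hdd, hfd, zero_add, neg_zero, add_neg_cancel]
        exact map_zero _
  · change ∀ p : R.ι 0 →₀ A, (∃ t, coneDiff R.ι R.d f 0 t = p) ↔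
      p default ∈ I ⊔ Submodule.span A {v}
    intro p
    constructor
    · rintro ⟨t, rfl⟩
      obtain ⟨⟨p, q⟩, rfl⟩ := (sumEquiv A (R.ι 1) (R.ι 0)).symm.surjective t
      rw [coneDiff_zero]
      refine add_mem (Submodule.mem_sup_left ((R.exact_zero _).1 ⟨p, rfl⟩))
        (Submodule.mem_sup_right ?_)
      change f 0 q R.unique.default ∈ _
      rw [hf₀]
      exact Submodule.mem_span_singleton.2 ⟨_, rfl⟩
    · intro h
      obtain ⟨a, ha, b, hb, hab⟩ := Submodule.mem_sup.1 h
      obtain ⟨c, rfl⟩ := Submodule.mem_span_singleton.1 hb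
      obtain ⟨s, hs⟩ := (R.exact_zero (Finsupp.single default a)).2
        (by rwa [Finsupp.single_eq_same])
      refine ⟨(sumEquiv A (R.ι 1) (R.ι 0)).symm (s, Finsupp.single default c), ?_⟩
      rw [coneDiff_zero]
      refine Finsupp.unique_ext (α := R.ι 0) ?_
      refine (congr_arg₂ (· + ·) (congr($hs default)) (hf₀ (Finsupp.single default c))).trans ?_
      rw [Finsupp.single_eq_same, Finsupp.single_eq_same]
      exact hab

end Cone

section Trivial

variable {K A : Type u} [Field K] [Ring A] [Algebra K A] {x : ℕ → A} {N : ℕ}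

/-- The left modules `A ⧸ (x 0, …, x (k - 1))` have linear resolutions of length exactly `k`. -/
theorem IsQuadraticSkewPBW.exists_resolution (hx : IsQuadraticSkewPBW K x N) {k : ℕ} (hk : k ≤ N) :
    ∃ R : CyclicLinearResolution (generatorSpan K x N) (initialIdeal x k),
      (∀ i, k < i → IsEmpty (R.ι i)) ∧ Nonempty (R.ι k) := by
  induction k with
  | zero =>
    refine ⟨{ ι := fun i => match i with | 0 => PUnit | _ + 1 => PEmpty,
              unique := inferInstanceAs (Unique PUnit)
              d := fun i => 0
              d_mem := fun i k l => zero_mem _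
              exact_succ := fun i p => ?_
              exact_zero := fun p => ?_ }, fun i hi => ?_, ⟨PUnit.unit⟩⟩
    · have : p = 0 := Finsupp.ext fun k => k.elim
      simp [this]
    · have : initialIdeal x 0 = ⊥ := by simp [initialIdeal]
      rw [this, LinearMap.range_zero, Submodule.mem_bot, Submodule.mem_bot]
      refine ⟨fun h => by rw [h]; rfl, fun h => Finsupp.ext fun k => ?_⟩
      exact h
    · obtain ⟨i, rfl⟩ := Nat.exists_eq_succ_of_ne_zero hi.ne'
      exact inferInstanceAs (IsEmpty PEmpty)
  | succ k ih =>
    obtain ⟨R, hR, hR'⟩ := ih (by omega)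
    have hv : x k ∈ generatorSpan K x N := Submodule.subset_span ⟨k, hk, rfl⟩
    obtain ⟨f, hf, hf₀, hfd⟩ := R.exists_chainMap hx hv fun a ha => hx.mul_mem_initialIdeal hk ha
    obtain ⟨S, hS⟩ := R.exists_cone hf hf₀ hfd fun a ha => hx.mem_initialIdeal_of_mul_mem hk ha
    rw [initialIdeal_succ]
    refine ⟨S, fun i hi => ?_, ?_⟩
    · rw [hS]
      obtain ⟨i, rfl⟩ := Nat.exists_eq_succ_of_ne_zero (Nat.ne_zero_of_lt hi)
      have := hR (i + 1) (by omega)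
      have := hR i (by omega)
      exact inferInstanceAs (IsEmpty (R.ι (i + 1) ⊕ R.ι i))
    · rw [hS]
      -- The top term of the cone is the shifted copy of the previous top term, so the length grows
      -- by exactly one.
      exact hR'.map Sum.inr

end Trivial

open CategoryTheory

/-! ### Lower bound for the global dimension. -/

section LowerBound

variable {K A : Type u} [Field K] [Ring A] [Algebra K A]

theorem hasProjectiveDimensionLT_free (ι : Type u) (n : ℕ) :
    HasProjectiveDimensionLT (ModuleCat.of A (ι →₀ A)) (n + 1) := by
  have : Projective (ModuleCat.of A (ι →₀ A)) := (IsProjective.iff_projective _).1 inferInstance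
  exact hasProjectiveDimensionLT_of_ge _ 1 _ (by omega)

/-- Otherwise dimension shifting makes the image of `d m` projective, so the last differential `d (m
+ 1)` has a retraction. But its entries vanish under `ε`, so reducing retraction ∘ differential =
identity along `ε` gives `1 = 0` in `K`. -/
theorem CyclicLinearResolution.not_hasProjectiveDimensionLT {V : Submodule K A} {I : Submodule A A}
    (R : CyclicLinearResolution V I) {ε : A →ₐ[K] K} (hε : ∀ v ∈ V, ε v = 0) {m : ℕ}
    [IsEmpty (R.ι (m + 3))] [Nonempty (R.ι (m + 2))] :
    ¬ HasProjectiveDimensionLT (ModuleCat.of A (A ⧸ I)) (m + 2) := by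
  intro hpd
  let := R.unique
  have syzygy : ∀ i ≤ m, HasProjectiveDimensionLT (ModuleCat.of A (LinearMap.range (R.d i)))
      (m - i + 1) := by
    intro i hi
    induction i with
    | zero =>
      let g : (R.ι 0 →₀ A) →ₗ[A] A ⧸ I := I.mkQ ∘ₗ Finsupp.lapply default
      have hg : Function.Surjective g := (Submodule.mkQ_surjective I).comp fun a =>
        ⟨Finsupp.single default a, by simp⟩
      have hex : Function.Exact (LinearMap.range (R.d 0)).subtype g := by
        intro p
        rw [LinearMap.comp_apply, Submodule.mkQ_apply, Submodule.Quotient.mk_eq_zero]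
        change p default ∈ I ↔ _
        exact (R.exact_zero p).symm.trans (by simp)
      exact (moduleCat_shortExact (Submodule.subtype_injective _) hex hg).hasProjectiveDimensionLT_X₁
        (m + 1) (hasProjectiveDimensionLT_free _ _) hpd
    | succ i ih =>
      have hg := (R.d i).surjective_rangeRestrict
      have hex : Function.Exact (LinearMap.range (R.d (i + 1))).subtype (R.d i).rangeRestrict := by
        intro p
        rw [← Subtype.coe_inj]
        change R.d i p = 0 ↔ _
        rw [R.exact_succ i p]
        simp
      have h := ih (by omega)
      rw [show m - i + 1 = m - (i + 1) + 1 + 1 by omega] at h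
      exact (moduleCat_shortExact (Submodule.subtype_injective _) hex hg).hasProjectiveDimensionLT_X₁
        _ (hasProjectiveDimensionLT_free _ _) h
  have hlast := syzygy m le_rfl
  rw [Nat.sub_self] at hlast
  have hproj : Module.Projective A (LinearMap.range (R.d m)) :=
    (IsProjective.iff_projective _).2
      (projective_iff_hasProjectiveDimensionLT_one (X := ModuleCat.of A _) |>.2 hlast)
  obtain ⟨s, hs⟩ := (R.d m).rangeRestrict.exists_rightInverse_of_surjective
    (LinearMap.range_eq_top.2 (R.d m).surjective_rangeRestrict)
  let D := R.d (m + 1)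
  have hD : Function.Injective D := by
    rw [injective_iff_map_eq_zero]
    intro p hp
    obtain ⟨q, rfl⟩ := (R.exact_succ (m + 1) p).1 hp
    rw [Subsingleton.elim q 0, map_zero]
  -- A section of `d m` yields a projection onto its kernel, which is the image of the injective map
  -- `D`; inverting `D` on that image gives the retraction `r`.
  have hmem : ∀ p, (LinearMap.id - s ∘ₗ (R.d m).rangeRestrict : Module.End A _) p ∈
      LinearMap.range D := fun p => by
    refine (R.exact_succ m _).1 ?_
    have := congr(($hs ((R.d m).rangeRestrict p)).1)
    rw [LinearMap.sub_apply, map_sub, sub_eq_zero]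
    exact this.symm
  let r : (R.ι (m + 1) →₀ A) →ₗ[A] (R.ι (m + 2) →₀ A) :=
    (LinearEquiv.ofInjective D hD).symm.toLinearMap ∘ₗ LinearMap.codRestrict _ _ hmem
  have hr : ∀ p, r (D p) = p := by
    intro p
    rw [LinearMap.comp_apply, LinearEquiv.coe_coe, LinearEquiv.symm_apply_eq]
    ext1
    have h0 : (R.d m).rangeRestrict (D p) = 0 :=
      Subtype.ext ((R.exact_succ m).apply_apply_eq_zero p)
    rw [LinearMap.codRestrict_apply, LinearMap.sub_apply, LinearMap.comp_apply, h0, map_zero,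
      sub_zero]
    rfl
  obtain ⟨j⟩ := ‹Nonempty (R.ι (m + 2))›
  have hvanish : ∀ p : R.ι (m + 1) →₀ A, (∀ l, ε (p l) = 0) → ε (r p j) = 0 := by
    intro p hp
    have hsum : r p = p.sum fun l a => a • r (Finsupp.single l 1) := by
      conv_lhs => rw [← p.sum_single, Finsupp.sum, map_sum]
      refine Finset.sum_congr rfl fun l _ => ?_
      change r (Finsupp.single l (p l)) = p l • r (Finsupp.single l 1)
      rw [← map_smul, Finsupp.smul_single, smul_eq_mul, mul_one]
    rw [hsum, Finsupp.sum, Finsupp.finsetSum_apply, map_sum]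
    refine Finset.sum_eq_zero fun l _ => ?_
    rw [Finsupp.smul_apply, smul_eq_mul, map_mul, hp l, zero_mul]
  have := hvanish (D (Finsupp.single j 1)) fun l => hε _ (R.d_mem (m + 1) j l)
  rw [hr, Finsupp.single_eq_same, map_one] at this
  exact one_ne_zero this

variable {x : ℕ → A} {N : ℕ}

theorem IsQuadraticSkewPBW.le_globalDimension (hx : IsQuadraticSkewPBW K x N) (hN : 2 ≤ N) :
    N ≤ globalDimension A := by
  -- The splitting argument uses two consecutive differentials, hence the shift by two.
  obtain ⟨m, rfl⟩ := Nat.exists_eq_add_of_le' hN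
  obtain ⟨R, hR, hR'⟩ := hx.exists_resolution le_rfl
  obtain ⟨ε, hε⟩ := hx.augmentation
  have := hR (m + 3) (by omega)
  refine le_iSup_of_le (ModuleCat.of A (A ⧸ initialIdeal x (m + 2))) ?_
  refine (projectiveDimension_ge_iff _ _).2 (R.not_hasProjectiveDimensionLT (ε := ε) fun v hv => ?_)
  refine Submodule.span_le (p := LinearMap.ker ε.toLinearMap) |>.2 ?_ hv
  rintro _ ⟨i, hi, rfl⟩
  exact hε i hi

theorem IsQuadraticSkewPBW.globalDimension_eq (hx : IsQuadraticSkewPBW K x N) (hN : 2 ≤ N) :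
    globalDimension A = N :=
  le_antisymm hx.globalDimension_le (hx.le_globalDimension hN)

end LowerBound

/-! ### Invariance of the global dimension. -/

section RingEquiv

theorem globalDimension_le_of_ringEquiv {R S : Type u} [Ring R] [Ring S] (e : R ≃+* S) :
    globalDimension S ≤ globalDimension R := by
  refine iSup_le fun M => ?_
  let : Module R M := Module.compHom M (e : R →+* S)
  let := RingHomInvPair.of_ringEquiv e
  let := RingHomInvPair.of_ringEquiv e.symm
  let e' : ModuleCat.of R M ≃ₛₗ[RingHomClass.toRingHom e] M :=
    { AddEquiv.refl M with map_smul' := fun _ _ => rfl }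
  rw [← ModuleCat.projectiveDimension_eq_of_semiLinearEquiv e e']
  exact le_iSup (fun M : ModuleCat.{u} R => projectiveDimension M) _

theorem globalDimension_eq_of_ringEquiv {R S : Type u} [Ring R] [Ring S] (e : R ≃+* S) :
    globalDimension R = globalDimension S :=
  le_antisymm (globalDimension_le_of_ringEquiv e.symm) (globalDimension_le_of_ringEquiv e)

end RingEquiv

/-! ### The linear resolution of the trivial module. -/

section Koszul

variable {K A : Type u} [Field K] [Ring A] [Algebra K A] {x : ℕ → A} {N : ℕ}

theorem augmentationIdeal_pow_eq :
    augmentationIdeal (fun d => generatorSpan K x N ^ d) = initialIdeal x N := by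
  apply le_antisymm
  · refine Submodule.span_le.2 ?_
    rintro a ⟨d, hd, ha⟩
    obtain ⟨d, rfl⟩ := Nat.exists_eq_add_of_le' hd
    simp only [pow_succ] at ha
    induction ha using Submodule.mul_induction_on' with
    | mem_mul_mem b _ v hv =>
      refine Submodule.smul_mem _ b ?_
      exact Submodule.span_le_restrictScalars K A _ hv
    | add a _ b _ ha hb => exact add_mem ha hb
  · refine Submodule.span_le.2 ?_
    rintro _ ⟨i, hi, rfl⟩
    refine Submodule.subset_span ⟨1, le_rfl, ?_⟩
    simp only [pow_one]
    exact Submodule.subset_span ⟨i, hi, rfl⟩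

theorem IsQuadraticSkewPBW.nonempty_linearFreeResolution (hx : IsQuadraticSkewPBW K x N) :
    Nonempty (LinearFreeResolution fun d => generatorSpan K x N ^ d) := by
  obtain ⟨R, -⟩ := hx.exists_resolution le_rfl
  let := R.unique
  let J := augmentationIdeal fun d => generatorSpan K x N ^ d
  exact ⟨{
    ι := R.ι
    d := R.d
    ε := J.mkQ ∘ₗ Finsupp.lapply default
    d_linear := fun i k l => by simpa using R.d_mem i k l
    ε_degree_zero := fun k => ⟨1, by simp [Submodule.one_le.1 le_rfl], by
      obtain rfl : k = default := Subsingleton.elim _ _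
      simp [J]⟩
    exact_succ := R.exact_succ
    exact_zero := fun p => by
      rw [LinearMap.comp_apply, Submodule.mkQ_apply, Submodule.Quotient.mk_eq_zero]
      change p default ∈ J ↔ _
      rw [show J = initialIdeal x N from augmentationIdeal_pow_eq]
      exact (R.exact_zero p).symm
    surjective := (Submodule.mkQ_surjective _).comp fun a => ⟨Finsupp.single default a, by simp⟩ }⟩

end Koszul

/-! ### Grading and Hilbert series. -/

section Hilbert

theorem card_piAntidiag_range (N d : ℕ) :
    ((Finset.range (N + 1)).piAntidiag d).card = (N + d).choose N := by
  have h : ((Finset.range (N + 1)).piAntidiag d).card =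
      ((Finset.range (N + 1)).finsuppAntidiag d).card := by
    refine (Finset.card_bij (fun (f : ℕ →₀ ℕ) _ => ⇑f) (fun f hf => ?_)
      (fun f _ g _ h => DFunLike.coe_injective h) fun f hf => ?_).symm
    · rw [Finset.mem_finsuppAntidiag] at hf
      exact Finset.mem_piAntidiag.2 ⟨hf.1, fun i hi => hf.2 (Finsupp.mem_support_iff.2 hi)⟩
    · rw [Finset.mem_piAntidiag] at hf
      refine ⟨Finsupp.onFinset _ f hf.2, ?_, rfl⟩
      exact Finset.mem_finsuppAntidiag.2 ⟨hf.1, Finsupp.support_onFinset_subset⟩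
  rw [h, Finset.card_finsuppAntidiag_nat_eq_choose, Finset.card_range,
    Nat.add_right_comm, Nat.add_sub_cancel, Nat.choose_symm_add]

variable {K A : Type u} [Field K] [Ring A] [Algebra K A] {x : ℕ → A} {N : ℕ}
variable (hx : IsQuadraticSkewPBW K x N)
include hx

theorem IsQuadraticSkewPBW.linearIndependent_orderedMonomial {ι : Type*} {f : ι → ℕ → ℕ}
    (hf : Function.Injective f) (hfe : ∀ i, f i ∈ exponents N) :
    LinearIndependent K fun i => orderedMonomial x N (f i) := by
  refine LinearIndependent.of_comp hx.repr ?_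
  have : ⇑hx.repr ∘ (fun i => orderedMonomial x N (f i)) = fun i => Finsupp.single (f i) 1 :=
    funext fun i => hx.repr_monomial (hfe i)
  rw [this]
  exact (Finsupp.linearIndependent_single_one K (ℕ → ℕ)).comp f hf

theorem IsQuadraticSkewPBW.finrank_span_orderedMonomial {S : Finset (ℕ → ℕ)}
    (hS : ∀ a ∈ S, a ∈ exponents N) :
    Module.finrank K (Submodule.span K (orderedMonomial x N '' S)) = S.card := by
  rw [Set.image_eq_range]
  exact (finrank_span_eq_card (ι := S) (hx.linearIndependent_orderedMonomial
    Subtype.val_injective fun i => hS i.1 i.2)).trans (Fintype.card_coe S)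

/-- The projection to degree `d` fixes the left-hand side and, on the spanning ordered monomials,
keeps those of total degree `d` and kills the others. -/
theorem IsQuadraticSkewPBW.pow_eq_span (d : ℕ) :
    generatorSpan K x N ^ d =
      Submodule.span K (orderedMonomial x N '' ((Finset.range N).piAntidiag d)) := by
  apply le_antisymm
  · intro y hy
    rw [← hx.component_of_mem hy]
    clear hy
    induction y using hx.induction with
    | hmon a ha =>
      have hm := orderedMonomial_mem_pow (K := K) (x := x) (le_refl N) a
      by_cases h : ∑ i ∈ Finset.range N, a i = d
      · subst h
        rw [hx.component_of_mem hm]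
        refine Submodule.subset_span ⟨a, Finset.mem_coe.2 (Finset.mem_piAntidiag.2 ⟨rfl, ?_⟩), rfl⟩
        intro i hi
        by_contra h
        exact hi (ha i (by simpa using h))
      · rw [hx.component_of_mem_of_ne hm h]
        exact zero_mem _
    | hadd a b ha hb => rw [map_add]; exact add_mem ha hb
    | hsmul r a ha => rw [map_smul]; exact Submodule.smul_mem _ r ha
  · refine Submodule.span_le.2 ?_
    rintro _ ⟨a, ha, rfl⟩
    rw [Finset.mem_coe, Finset.mem_piAntidiag] at ha
    rw [← ha.1]
    exact orderedMonomial_mem_pow le_rfl a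

theorem IsQuadraticSkewPBW.finrank_pow (d : ℕ) :
    Module.finrank K ↥(generatorSpan K x N ^ d) = ((Finset.range N).piAntidiag d).card := by
  rw [hx.pow_eq_span]
  refine hx.finrank_span_orderedMonomial fun a ha i hi => ?_
  by_contra h
  exact absurd (Finset.mem_range.1 ((Finset.mem_piAntidiag.1 ha).2 i h)) hi.not_gt

theorem IsQuadraticSkewPBW.hilbertSeries_eq (hN : 1 ≤ N) :
    hilbertSeries (fun d => generatorSpan K x N ^ d) = ((1 - PowerSeries.X : ℚ⟦X⟧) ^ N)⁻¹ := by
  obtain ⟨N, rfl⟩ := Nat.exists_eq_add_of_le' hN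
  rw [PowerSeries.eq_inv_iff_mul_eq_one (by simp)]
  refine Eq.trans ?_ (PowerSeries.mk_add_choose_mul_one_sub_pow_eq_one ℚ N)
  congr 1
  ext d
  rw [hilbertSeries, PowerSeries.coeff_mk, PowerSeries.coeff_mk, hx.finrank_pow,
    card_piAntidiag_range]

omit hx in
theorem finite_pow (d : ℕ) : Module.Finite K ↥(generatorSpan K x N ^ d) := by
  have h : (generatorSpan K x N).FG :=
    Submodule.fg_span ((Set.finite_Iio N).image x)
  exact Module.Finite.iff_fg.2 (h.pow d)

theorem IsQuadraticSkewPBW.isConnectedGradedAlgebra :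
    IsConnectedGradedAlgebra (fun d => generatorSpan K x N ^ d) where
  nontrivial := hx.augmentation.choose.toRingHom.domain_nontrivial
  gradedMonoid := Submodule.nat_power_gradedMonoid _
  isInternal := by
    refine DirectSum.isInternal_submodule_of_iSupIndep_of_iSup_eq_top ?_ ?_
    · rw [iSupIndep_def]
      intro d
      rw [Submodule.disjoint_def]
      intro y hy hy'
      rw [← hx.component_of_mem hy]
      have : (⨆ j, ⨆ (_ : j ≠ d), generatorSpan K x N ^ j) ≤ LinearMap.ker (hx.component d) :=
        iSup₂_le fun j hj y hy => hx.component_of_mem_of_ne hy hj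
      exact this hy'
    · rw [eq_top_iff]
      intro y _
      induction y using hx.induction with
      | hmon a _ => exact Submodule.mem_iSup_of_mem _ (orderedMonomial_mem_pow le_rfl a)
      | hadd a b ha hb => exact add_mem (ha trivial) (hb trivial)
      | hsmul r a ha => exact Submodule.smul_mem _ r (ha trivial)
  degree_zero := pow_zero _
  finite := finite_pow

end Hilbert

/-! ### Gelfand–Kirillov dimension. -/

section GelfandKirillov

/-- The exponent vectors supported below `N` with entries at most `m`. -/
def exponentBox (N m : ℕ) : Finset (ℕ → ℕ) :=
  (Fintype.piFinset fun _ : Fin N => Finset.range (m + 1)).map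
    ⟨fun f i => if h : i < N then f ⟨i, h⟩ else 0, fun f g h => funext fun i => by
      simpa using congr_fun h i⟩

theorem card_exponentBox (N m : ℕ) : (exponentBox N m).card = (m + 1) ^ N := by
  simp [exponentBox]

theorem mem_exponentBox {N m : ℕ} {a : ℕ → ℕ} :
    a ∈ exponentBox N m ↔ a ∈ exponents N ∧ ∀ i < N, a i ≤ m := by
  rw [exponentBox, Finset.mem_map]
  constructor
  · rintro ⟨f, hf, rfl⟩
    rw [Fintype.mem_piFinset] at hf
    refine ⟨fun i hi => dif_neg hi.not_gt, fun i hi => ?_⟩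
    exact (dif_pos hi).trans_le (Nat.le_of_lt_succ (Finset.mem_range.1 (hf ⟨i, hi⟩)))
  · rintro ⟨h, h'⟩
    refine ⟨fun i => a i, ?_, ?_⟩
    · rw [Fintype.mem_piFinset]
      exact fun i => Finset.mem_range.2 (Nat.lt_succ_of_le (h' i i.2))
    · ext i
      by_cases hi : i < N
      · exact dif_pos hi
      · exact (dif_neg hi).trans (h i (not_lt.1 hi)).symm

variable {K A : Type u} [Field K] [Ring A] [Algebra K A] {x : ℕ → A} {N : ℕ}

theorem one_sup_pow_le (V : Submodule K A) (m : ℕ) : (1 ⊔ V) ^ m ≤ ⨆ d ∈ Set.Iic m, V ^ d := by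
  induction m with
  | zero => exact le_iSup₂_of_le 0 (Set.mem_Iic.2 le_rfl) (by rw [pow_zero, pow_zero])
  | succ m ih =>
    rw [pow_succ]
    refine (mul_le_mul' ih le_rfl).trans ?_
    simp only [Submodule.iSup_mul, Submodule.mul_sup, mul_one, ← pow_succ]
    refine sup_le (iSup₂_le fun d hd => ?_) (iSup₂_le fun d hd => ?_)
    · exact le_iSup₂_of_le d (Set.mem_Iic.2 (Nat.le_succ_of_le hd)) le_rfl
    · exact le_iSup₂_of_le (d + 1) (Set.mem_Iic.2 (Nat.succ_le_succ hd)) le_rfl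

theorem one_sup_pow_mono (V : Submodule K A) {k l : ℕ} (h : k ≤ l) : (1 ⊔ V) ^ k ≤ (1 ⊔ V) ^ l :=
  pow_le_pow_right₀ le_sup_left h

theorem pow_le_one_sup_pow (V : Submodule K A) {d m : ℕ} (h : d ≤ m) : V ^ d ≤ (1 ⊔ V) ^ m :=
  (pow_le_pow_left' le_sup_right d).trans (one_sup_pow_mono V h)

variable (hx : IsQuadraticSkewPBW K x N)
include hx

theorem IsQuadraticSkewPBW.finrank_filtration_le (m : ℕ) :
    Module.finrank K ↥((1 ⊔ generatorSpan K x N) ^ m) ≤ (m + 1) ^ N := by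
  have h : (1 ⊔ generatorSpan K x N) ^ m ≤
      Submodule.span K (orderedMonomial x N '' exponentBox N m) := by
    refine (one_sup_pow_le _ _).trans (iSup₂_le fun d hd => ?_)
    rw [hx.pow_eq_span]
    refine Submodule.span_mono (Set.image_mono fun a ha => ?_)
    rw [Finset.mem_coe, Finset.mem_piAntidiag] at ha
    refine mem_exponentBox.2 ⟨fun i hi => ?_, fun i hi => ?_⟩
    · by_contra h
      exact absurd (Finset.mem_range.1 (ha.2 i h)) hi.not_gt
    · exact ((Finset.single_le_sum (fun j _ => Nat.zero_le (a j)) (Finset.mem_range.2 hi)).trans_eq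
        ha.1).trans hd
  have : Module.Finite K ↥(Submodule.span K (orderedMonomial x N '' exponentBox N m)) :=
    Module.Finite.span_of_finite K ((Finset.finite_toSet _).image _)
  refine (Submodule.finrank_mono h).trans_eq ?_
  rw [hx.finrank_span_orderedMonomial fun a ha => (mem_exponentBox.1 ha).1, card_exponentBox]

omit hx in
theorem finite_filtration (V : Submodule K A) [Module.Finite K V] (m : ℕ) :
    Module.Finite K ↥((1 ⊔ V) ^ m) := by
  have h1 : (1 : Submodule K A).FG := by
    rw [Submodule.one_eq_span]; exact Submodule.fg_span_singleton 1
  exact Module.Finite.iff_fg.2 ((h1.sup (Module.Finite.iff_fg.1 inferInstance)).pow m)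

/-- If each of the `N` exponents is at most `m / N`, the total degree is at most `m`, so a full box
of independent monomials fits into the filtration. -/
theorem IsQuadraticSkewPBW.le_finrank_filtration (m : ℕ) :
    (m / N + 1) ^ N ≤ Module.finrank K ↥((1 ⊔ generatorSpan K x N) ^ m) := by
  have h : Submodule.span K (orderedMonomial x N '' exponentBox N (m / N)) ≤
      (1 ⊔ generatorSpan K x N) ^ m := by
    refine Submodule.span_le.2 ?_
    rintro _ ⟨a, ha, rfl⟩
    refine pow_le_one_sup_pow _ ?_ (orderedMonomial_mem_pow le_rfl a)
    refine (Finset.sum_le_card_nsmul _ _ (m / N) fun i hi =>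
      (mem_exponentBox.1 ha).2 i (Finset.mem_range.1 hi)).trans ?_
    rw [Finset.card_range, smul_eq_mul]
    exact Nat.mul_div_le m N
  have : Module.Finite K (generatorSpan K x N) :=
    Module.Finite.span_of_finite K ((Set.finite_Iio N).image x)
  have := finite_filtration (generatorSpan K x N) m
  refine le_trans (le_of_eq ?_) (Submodule.finrank_mono h)
  rw [hx.finrank_span_orderedMonomial fun a ha => (mem_exponentBox.1 ha).1, card_exponentBox]

theorem IsQuadraticSkewPBW.exists_le_filtration (V : Submodule K A) [Module.Finite K V] :
    ∃ k, V ≤ (1 ⊔ generatorSpan K x N) ^ k := by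
  obtain ⟨s, rfl⟩ := Module.Finite.iff_fg.1 ‹Module.Finite K V›
  have : ∀ y : A, ∃ k, y ∈ (1 ⊔ generatorSpan K x N) ^ k := by
    intro y
    induction y using hx.induction with
    | hmon a _ => exact ⟨_, pow_le_one_sup_pow _ le_rfl (orderedMonomial_mem_pow le_rfl a)⟩
    | hadd a b ha hb =>
      obtain ⟨k, hk⟩ := ha
      obtain ⟨l, hl⟩ := hb
      exact ⟨max k l, add_mem (one_sup_pow_mono _ (le_max_left k l) hk)
        (one_sup_pow_mono _ (le_max_right k l) hl)⟩
    | hsmul r a ha => exact ha.imp fun k hk => Submodule.smul_mem _ r hk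
  choose k hk using this
  exact ⟨s.sup k, Submodule.span_le.2 fun y hy =>
    one_sup_pow_mono _ (Finset.le_sup (f := k) hy) (hk y)⟩

-- The constant `c` absorbs the factors by which the two dimension estimates differ from `m ^ N`: it
-- is `log (k + 1)` in the upper bound and `-log N` in the lower one.
omit hx in
theorem tendsto_log_ratio (c : ℝ) (N : ℕ) :
    Filter.Tendsto (fun m : ℕ => (((N * (c + Real.log m)) / Real.log m : ℝ) : EReal)) Filter.atTop
      (nhds (N : EReal)) := by
  have hlog : Filter.Tendsto (fun m : ℕ => Real.log (m : ℝ)) Filter.atTop Filter.atTop :=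
    Real.tendsto_log_atTop.comp tendsto_natCast_atTop_atTop
  have h1 : Filter.Tendsto (fun m : ℕ => N * (c / Real.log (m : ℝ) + 1)) Filter.atTop
      (nhds (N * (0 + 1))) :=
    ((hlog.const_div_atTop c).add_const 1).const_mul _
  rw [zero_add, mul_one] at h1
  have h2 : Filter.Tendsto (fun m : ℕ => ((N * (c + Real.log m)) / Real.log m : ℝ)) Filter.atTop
      (nhds (N : ℝ)) := by
    refine h1.congr' ?_
    filter_upwards [hlog.eventually_gt_atTop 0] with m hm
    field_simp
  exact EReal.tendsto_coe.2 h2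

theorem IsQuadraticSkewPBW.gelfandKirillovDimension_eq (hN : 1 ≤ N) :
    gelfandKirillovDimension K A = (N : EReal) := by
  have hN' : (0 : ℝ) < N := by exact_mod_cast hN
  apply le_antisymm
  · refine iSup₂_le fun V hV => ?_
    obtain ⟨k, hk⟩ := hx.exists_le_filtration V
    rw [← (tendsto_log_ratio (Real.log (k + 1)) N).limsup_eq]
    refine Filter.limsup_le_limsup ?_
    filter_upwards [Filter.eventually_ge_atTop 2] with m hm
    have hm' : (2 : ℝ) ≤ m := by exact_mod_cast hm
    rw [EReal.coe_le_coe_iff]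
    refine div_le_div_of_nonneg_right ?_ (Real.log_nonneg (by linarith))
    -- Any `V` lies in some filtration step `k`, so its `m`-th power lies in step `k * m`: rescaling
    -- `m` does not change the growth exponent.
    have h1 : (1 ⊔ V) ^ m ≤ (1 ⊔ generatorSpan K x N) ^ (k * m) := by
      rw [pow_mul]
      exact pow_le_pow_left' (sup_le (one_le_pow₀ le_sup_left) hk) m
    have : Module.Finite K (generatorSpan K x N) :=
      Module.Finite.span_of_finite K ((Set.finite_Iio N).image x)
    have := finite_filtration (generatorSpan K x N) (k * m)
    have h2 : Module.finrank K ↥((1 ⊔ V) ^ m) ≤ ((k + 1) * m) ^ N :=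
      ((Submodule.finrank_mono h1).trans (hx.finrank_filtration_le _)).trans
        (Nat.pow_le_pow_left (by nlinarith) N)
    rw [← Real.log_mul (by positivity) (by positivity), ← Real.log_pow]
    rcases Nat.eq_zero_or_pos (Module.finrank K ↥((1 ⊔ V) ^ m)) with h0 | h0
    · rw [h0, Nat.cast_zero, Real.log_zero]
      refine Real.log_nonneg (one_le_pow₀ ?_)
      have : (0 : ℝ) ≤ k := Nat.cast_nonneg k
      nlinarith
    · exact Real.log_le_log (by exact_mod_cast h0) (by exact_mod_cast h2)
  · have : Module.Finite K (generatorSpan K x N) :=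
      Module.Finite.span_of_finite K ((Set.finite_Iio N).image x)
    refine le_iSup₂_of_le (generatorSpan K x N) this ?_
    rw [← (tendsto_log_ratio (-Real.log N) N).limsup_eq]
    refine Filter.limsup_le_limsup ?_
    filter_upwards [Filter.eventually_ge_atTop 2] with m hm
    have hm' : (2 : ℝ) ≤ m := by exact_mod_cast hm
    rw [EReal.coe_le_coe_iff]
    refine div_le_div_of_nonneg_right ?_ (Real.log_nonneg (by linarith))
    have h1 : ((m : ℝ) / N) ^ N ≤ Module.finrank K ↥((1 ⊔ generatorSpan K x N) ^ m) := by
      refine le_trans (pow_le_pow_left₀ (by positivity) ?_ N)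
        (by exact_mod_cast hx.le_finrank_filtration m : ((m / N + 1 : ℕ) : ℝ) ^ N ≤ _)
      rw [div_le_iff₀ hN']
      exact_mod_cast (Nat.lt_mul_of_div_lt (Nat.lt_succ_self _) hN).le
    rw [neg_add_eq_sub, ← Real.log_div (by positivity) (by positivity), ← Real.log_pow]
    exact Real.log_le_log (by positivity) h1

end GelfandKirillov

/-! ### The skew derivation attached to a letter respects the relations. -/

namespace QuantumMatrixAlgebra

/-- The scalar `c` in the relation `z_a z_b = c z_b z_a + ⋯`. -/
def swapScalar {K ι : Type*} [Field K] [LinearOrder ι] (q : K) (a b : ι × ι) : K :=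
  (if a.1 = b.1 then q else 1) * (if a.2 = b.2 then q else 1)

/-- The coefficient of the quadratic correction term in the relation between `z_a` and `z_b`. -/
def swapCorr {K ι : Type*} [Field K] [LinearOrder ι] (q : K) (a b : ι × ι) : K :=
  if a.1 < b.1 ∧ a.2 < b.2 then q - q⁻¹ else 0

-- With `σ (z a) = swapScalar q p a • z a` and `δ (z a)` the correction term of `z_p z_a`, this is
-- the rule `δ (a b) = σ a * δ b + δ a * b` applied to both sides of the relation between `z a` and
-- `z b`. In each relative position of the rows and columns of `p`, `a`, `b`, both sides are
-- straightened to a common order and scalars are compared.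
set_option linter.unusedSimpArgs false in
set_option maxHeartbeats 1600000 in
theorem skewDerivation_rel {K ι B : Type*} [Field K] [LinearOrder ι] [Ring B] [Algebra K B]
    {q : K} (hq : q ≠ 0) (z : ι × ι → B) (p : ι × ι)
    (H : ∀ a b : ι × ι, toLex p < toLex a → toLex a < toLex b →
      z a * z b = swapScalar q a b • (z b * z a)
        + swapCorr q a b • (z (a.1, b.2) * z (b.1, a.2)))
    (a b : ι × ι) (hpa : toLex p < toLex a) (hab : toLex a < toLex b) :
    (swapScalar q p a • z a) * (swapCorr q p b • (z (p.1, b.2) * z (b.1, p.2)))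
      + (swapCorr q p a • (z (p.1, a.2) * z (a.1, p.2))) * z b =
    swapScalar q a b • ((swapScalar q p b • z b) * (swapCorr q p a • (z (p.1, a.2) * z (a.1, p.2)))
      + (swapCorr q p b • (z (p.1, b.2) * z (b.1, p.2))) * z a)
    + swapCorr q a b • ((swapScalar q p (a.1, b.2) • z (a.1, b.2)) *
          (swapCorr q p (b.1, a.2) • (z (p.1, a.2) * z (b.1, p.2)))
        + (swapCorr q p (a.1, b.2) • (z (p.1, b.2) * z (a.1, p.2))) * z (b.1, a.2)) := by
  obtain ⟨i, j⟩ := p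
  obtain ⟨s, t⟩ := a
  obtain ⟨u, v⟩ := b
  have row : ∀ s t v, (i < s ∨ i = s ∧ j < t) → t < v → z (s, t) * z (s, v) =
      q • (z (s, v) * z (s, t)) := fun s t v h h' => by
    have := H (s, t) (s, v) (by simpa [Prod.Lex.toLex_lt_toLex] using h)
      (by simpa [Prod.Lex.toLex_lt_toLex] using h')
    simpa [swapScalar, swapCorr, h'.ne] using this
  have col : ∀ s u t, (i < s ∨ i = s ∧ j < t) → s < u → z (s, t) * z (u, t) =
      q • (z (u, t) * z (s, t)) := fun s u t h h' => by
    have := H (s, t) (u, t) (by simpa [Prod.Lex.toLex_lt_toLex] using h)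
      (by simpa [Prod.Lex.toLex_lt_toLex] using h')
    simpa [swapScalar, swapCorr, h'.ne] using this
  have anti : ∀ s t u v, (i < s ∨ i = s ∧ j < t) → s < u → v < t → z (s, t) * z (u, v) =
      z (u, v) * z (s, t) := fun s t u v h h' h2 => by
    have := H (s, t) (u, v) (by simpa [Prod.Lex.toLex_lt_toLex] using h)
      (by simp [Prod.Lex.toLex_lt_toLex, h'])
    simpa [swapScalar, swapCorr, h'.ne, h2.ne', h2.not_gt] using this
  have diag : ∀ s t u v, (i < s ∨ i = s ∧ j < t) → s < u → t < v → z (s, t) * z (u, v) =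
      z (u, v) * z (s, t) + (q - q⁻¹) • (z (u, t) * z (s, v)) := fun s t u v h h' h2 => by
    have := H (s, t) (u, v) (by simpa [Prod.Lex.toLex_lt_toLex] using h)
      (by simp [Prod.Lex.toLex_lt_toLex, h'])
    -- The two letters of the correction term commute; swapping them puts the later letter first, so
    -- that rewriting ends in a normal form.
    have h3 := anti s v u t (h.imp id (And.imp id fun h => h.trans h2)) h' h2
    simpa [swapScalar, swapCorr, h'.ne, h2.ne, h', h2, h3] using this
  clear H
  -- Lets each relation fire inside right-nested products.
  have assoc : ∀ {x y w : B}, x * y = w → ∀ r, x * (y * r) = w * r := fun h r => by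
    rw [← mul_assoc, h]
  have tri : ∀ x y : ι, (x < y ∧ x ≠ y ∧ y ≠ x ∧ ¬ y < x) ∨ x = y ∨ (y < x ∧ x ≠ y ∧ y ≠ x ∧ ¬ x < y) := by
    intro x y
    rcases lt_trichotomy x y with h | h | h
    · exact Or.inl ⟨h, h.ne, h.ne', h.not_gt⟩
    · exact Or.inr (Or.inl h)
    · exact Or.inr (Or.inr ⟨h, h.ne', h.ne, h.not_gt⟩)
  simp only [Prod.Lex.toLex_lt_toLex] at hpa hab
  have hir : i < s ∨ i = s ∧ j < t := hpa
  rcases hab with h1 | ⟨rfl, h1⟩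
  · have hiu : i < u := by rcases hpa with h2 | ⟨rfl, h2⟩ <;> order
    have hiu' := hiu.ne
    have h1' := h1.ne
    rcases hpa with h2 | ⟨rfl, h2⟩
    · have h2' := h2.ne
      rcases tri j t with h3 | h3 | h3 <;> rcases tri j v with h4 | h4 | h4 <;>
      rcases tri t v with h5 | h5 | h5 <;>
      first
      | (exfalso; order)
      | (simp only [swapScalar, swapCorr, h1, h2, hiu, h1', h2', hiu', h3, h4, h5, lt_irrefl, and_true, true_and, and_false, false_and, and_self, if_true, if_false, ite_true, ite_false, zero_smul, mul_zero, zero_mul, add_zero, zero_add, smul_zero, one_smul, mul_one, one_mul, smul_mul_assoc, mul_smul_comm, mul_assoc, smul_smul]; done)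
      | simp only [swapScalar, swapCorr, h1, h2, hiu, h1', h2', hiu', h3, h4, h5, lt_irrefl, and_true, true_and, and_false, false_and, and_self, if_true, if_false, ite_true, ite_false, zero_smul, mul_zero, zero_mul, add_zero, zero_add, smul_zero, one_smul, mul_one, one_mul, smul_mul_assoc, mul_smul_comm, mul_assoc, smul_smul]
      · simp only [
          anti s t u j (Or.inl h2) h1 h3.1, assoc (anti s t u j (Or.inl h2) h1 h3.1),
          diag s t u v (Or.inl h2) h1 h5.1, assoc (diag s t u v (Or.inl h2) h1 h5.1),
          row s t v (Or.inl h2) h5.1, assoc (row s t v (Or.inl h2) h5.1),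
          col s u t (Or.inl h2) h1, assoc (col s u t (Or.inl h2) h1),
          anti i v s t (Or.inr ⟨rfl, h4.1⟩) h2 h5.1,
          assoc (anti i v s t (Or.inr ⟨rfl, h4.1⟩) h2 h5.1),
          anti i v u j (Or.inr ⟨rfl, h4.1⟩) hiu h4.1,
          assoc (anti i v u j (Or.inr ⟨rfl, h4.1⟩) hiu h4.1),
          anti i v s j (Or.inr ⟨rfl, h4.1⟩) h2 h4.1,
          assoc (anti i v s j (Or.inr ⟨rfl, h4.1⟩) h2 h4.1), col i u v (Or.inr ⟨rfl, h4.1⟩) hiu,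
          assoc (col i u v (Or.inr ⟨rfl, h4.1⟩) hiu), col i s v (Or.inr ⟨rfl, h4.1⟩) h2,
          assoc (col i s v (Or.inr ⟨rfl, h4.1⟩) h2), anti i v u t (Or.inr ⟨rfl, h4.1⟩) hiu h5.1,
          assoc (anti i v u t (Or.inr ⟨rfl, h4.1⟩) hiu h5.1), row u j v (Or.inl hiu) h4.1,
          assoc (row u j v (Or.inl hiu) h4.1), row u j t (Or.inl hiu) h3.1,
          assoc (row u j t (Or.inl hiu) h3.1), col i s t (Or.inr ⟨rfl, h3.1⟩) h2,
          assoc (col i s t (Or.inr ⟨rfl, h3.1⟩) h2), row i t v (Or.inr ⟨rfl, h3.1⟩) h5.1,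
          assoc (row i t v (Or.inr ⟨rfl, h3.1⟩) h5.1),
          anti i t u j (Or.inr ⟨rfl, h3.1⟩) hiu h3.1,
          assoc (anti i t u j (Or.inr ⟨rfl, h3.1⟩) hiu h3.1),
          anti i t s j (Or.inr ⟨rfl, h3.1⟩) h2 h3.1,
          assoc (anti i t s j (Or.inr ⟨rfl, h3.1⟩) h2 h3.1),
          diag i t u v (Or.inr ⟨rfl, h3.1⟩) hiu h5.1,
          assoc (diag i t u v (Or.inr ⟨rfl, h3.1⟩) hiu h5.1),
          diag i t s v (Or.inr ⟨rfl, h3.1⟩) h2 h5.1,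
          assoc (diag i t s v (Or.inr ⟨rfl, h3.1⟩) h2 h5.1), col i u t (Or.inr ⟨rfl, h3.1⟩) hiu,
          assoc (col i u t (Or.inr ⟨rfl, h3.1⟩) hiu), row s j t (Or.inl h2) h3.1,
          assoc (row s j t (Or.inl h2) h3.1), col s u j (Or.inl h2) h1,
          assoc (col s u j (Or.inl h2) h1), diag s j u v (Or.inl h2) h1 h4.1,
          assoc (diag s j u v (Or.inl h2) h1 h4.1), row s j v (Or.inl h2) h4.1,
          assoc (row s j v (Or.inl h2) h4.1), diag s j u t (Or.inl h2) h1 h3.1,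
          assoc (diag s j u t (Or.inl h2) h1 h3.1), anti s v u j (Or.inl h2) h1 h4.1,
          assoc (anti s v u j (Or.inl h2) h1 h4.1), col s u v (Or.inl h2) h1,
          assoc (col s u v (Or.inl h2) h1), anti s v u t (Or.inl h2) h1 h5.1,
          assoc (anti s v u t (Or.inl h2) h1 h5.1), row u t v (Or.inl hiu) h5.1,
          assoc (row u t v (Or.inl hiu) h5.1), mul_add, add_mul, smul_mul_assoc, mul_smul_comm,
          mul_assoc, smul_add]
        match_scalars <;> field_simp
      · subst h5
        simp only [
          anti s t u j (Or.inl h2) h1 h4.1, assoc (anti s t u j (Or.inl h2) h1 h4.1),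
          col s u t (Or.inl h2) h1, assoc (col s u t (Or.inl h2) h1),
          col i s t (Or.inr ⟨rfl, h4.1⟩) h2, assoc (col i s t (Or.inr ⟨rfl, h4.1⟩) h2),
          anti i t u j (Or.inr ⟨rfl, h4.1⟩) hiu h4.1,
          assoc (anti i t u j (Or.inr ⟨rfl, h4.1⟩) hiu h4.1),
          anti i t s j (Or.inr ⟨rfl, h4.1⟩) h2 h4.1,
          assoc (anti i t s j (Or.inr ⟨rfl, h4.1⟩) h2 h4.1), col i u t (Or.inr ⟨rfl, h4.1⟩) hiu,
          assoc (col i u t (Or.inr ⟨rfl, h4.1⟩) hiu), row u j t (Or.inl hiu) h4.1,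
          assoc (row u j t (Or.inl hiu) h4.1), row s j t (Or.inl h2) h4.1,
          assoc (row s j t (Or.inl h2) h4.1), col s u j (Or.inl h2) h1,
          assoc (col s u j (Or.inl h2) h1), diag s j u t (Or.inl h2) h1 h4.1,
          assoc (diag s j u t (Or.inl h2) h1 h4.1), mul_add, add_mul, smul_mul_assoc,
          mul_smul_comm, mul_assoc, smul_add]
        match_scalars <;> field_simp <;> ring
      · simp only [
          anti s t u j (Or.inl h2) h1 h3.1, assoc (anti s t u j (Or.inl h2) h1 h3.1),
          anti s t u v (Or.inl h2) h1 h5.1, assoc (anti s t u v (Or.inl h2) h1 h5.1),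
          diag i v s t (Or.inr ⟨rfl, h4.1⟩) h2 h5.1,
          assoc (diag i v s t (Or.inr ⟨rfl, h4.1⟩) h2 h5.1),
          anti i v u j (Or.inr ⟨rfl, h4.1⟩) hiu h4.1,
          assoc (anti i v u j (Or.inr ⟨rfl, h4.1⟩) hiu h4.1),
          row i v t (Or.inr ⟨rfl, h4.1⟩) h5.1, assoc (row i v t (Or.inr ⟨rfl, h4.1⟩) h5.1),
          anti i v s j (Or.inr ⟨rfl, h4.1⟩) h2 h4.1,
          assoc (anti i v s j (Or.inr ⟨rfl, h4.1⟩) h2 h4.1), col i u v (Or.inr ⟨rfl, h4.1⟩) hiu,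
          assoc (col i u v (Or.inr ⟨rfl, h4.1⟩) hiu), row u j v (Or.inl hiu) h4.1,
          assoc (row u j v (Or.inl hiu) h4.1), col i s t (Or.inr ⟨rfl, h3.1⟩) h2,
          assoc (col i s t (Or.inr ⟨rfl, h3.1⟩) h2), anti i t u j (Or.inr ⟨rfl, h3.1⟩) hiu h3.1,
          assoc (anti i t u j (Or.inr ⟨rfl, h3.1⟩) hiu h3.1),
          anti i t s j (Or.inr ⟨rfl, h3.1⟩) h2 h3.1,
          assoc (anti i t s j (Or.inr ⟨rfl, h3.1⟩) h2 h3.1),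
          anti i t u v (Or.inr ⟨rfl, h3.1⟩) hiu h5.1,
          assoc (anti i t u v (Or.inr ⟨rfl, h3.1⟩) hiu h5.1), row s j t (Or.inl h2) h3.1,
          assoc (row s j t (Or.inl h2) h3.1), col s u j (Or.inl h2) h1,
          assoc (col s u j (Or.inl h2) h1), diag s j u v (Or.inl h2) h1 h4.1,
          assoc (diag s j u v (Or.inl h2) h1 h4.1), anti i t s v (Or.inr ⟨rfl, h3.1⟩) h2 h5.1,
          assoc (anti i t s v (Or.inr ⟨rfl, h3.1⟩) h2 h5.1), mul_add, add_mul, smul_mul_assoc,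
          mul_smul_comm, mul_assoc, smul_add]
        match_scalars <;> field_simp
      · simp only [
          anti i t s v (Or.inr ⟨rfl, h3.1⟩) h2 h5.1,
          assoc (anti i t s v (Or.inr ⟨rfl, h3.1⟩) h2 h5.1),
          anti i t u v (Or.inr ⟨rfl, h3.1⟩) hiu h5.1,
          assoc (anti i t u v (Or.inr ⟨rfl, h3.1⟩) hiu h5.1), col s u v (Or.inl h2) h1,
          assoc (col s u v (Or.inl h2) h1), mul_add, add_mul, smul_mul_assoc, mul_smul_comm,
          mul_assoc, smul_add]
        match_scalars
        field_simp
      · simp only [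
          anti i t s j (Or.inr ⟨rfl, h3.1⟩) h2 h3.1,
          assoc (anti i t s j (Or.inr ⟨rfl, h3.1⟩) h2 h3.1),
          anti i t u v (Or.inr ⟨rfl, h3.1⟩) hiu h5.1,
          assoc (anti i t u v (Or.inr ⟨rfl, h3.1⟩) hiu h5.1), anti s j u v (Or.inl h2) h1 h4.1,
          assoc (anti s j u v (Or.inl h2) h1 h4.1), mul_add, add_mul, smul_mul_assoc,
          mul_smul_comm, mul_assoc, smul_add]
      · simp only [
          col s u t (Or.inl h2) h1, assoc (col s u t (Or.inl h2) h1),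
          anti i v s t (Or.inr ⟨rfl, h4.1⟩) h2 h5.1,
          assoc (anti i v s t (Or.inr ⟨rfl, h4.1⟩) h2 h5.1),
          anti i v u t (Or.inr ⟨rfl, h4.1⟩) hiu h5.1,
          assoc (anti i v u t (Or.inr ⟨rfl, h4.1⟩) hiu h5.1), mul_add, add_mul, smul_mul_assoc,
          mul_smul_comm, mul_assoc, smul_add]
        match_scalars
        field_simp
        ring
      · simp only [
          diag s t u j (Or.inl h2) h1 h3.1, assoc (diag s t u j (Or.inl h2) h1 h3.1),
          row s t j (Or.inl h2) h3.1, assoc (row s t j (Or.inl h2) h3.1),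
          col s u t (Or.inl h2) h1, assoc (col s u t (Or.inl h2) h1),
          anti i v s t (Or.inr ⟨rfl, h4.1⟩) h2 h5.1,
          assoc (anti i v s t (Or.inr ⟨rfl, h4.1⟩) h2 h5.1),
          anti i v u j (Or.inr ⟨rfl, h4.1⟩) hiu h4.1,
          assoc (anti i v u j (Or.inr ⟨rfl, h4.1⟩) hiu h4.1),
          anti i v s j (Or.inr ⟨rfl, h4.1⟩) h2 h4.1,
          assoc (anti i v s j (Or.inr ⟨rfl, h4.1⟩) h2 h4.1),
          anti i v u t (Or.inr ⟨rfl, h4.1⟩) hiu h5.1,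
          assoc (anti i v u t (Or.inr ⟨rfl, h4.1⟩) hiu h5.1), col s u j (Or.inl h2) h1,
          assoc (col s u j (Or.inl h2) h1), anti s j u t (Or.inl h2) h1 h3.1,
          assoc (anti s j u t (Or.inl h2) h1 h3.1), row u t j (Or.inl hiu) h3.1,
          assoc (row u t j (Or.inl hiu) h3.1), mul_add, add_mul, smul_mul_assoc, mul_smul_comm,
          mul_assoc, smul_add]
        match_scalars <;> field_simp
    · have h2' := h2.ne
      rcases tri j v with h4 | h4 | h4 <;>
      rcases tri t v with h5 | h5 | h5 <;>
      first
      | (exfalso; order)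
      | (simp only [swapScalar, swapCorr, h1, h2, hiu, h1', h2', hiu', h4, h5, lt_irrefl, and_true, true_and, and_false, false_and, and_self, if_true, if_false, ite_true, ite_false, zero_smul, mul_zero, zero_mul, add_zero, zero_add, smul_zero, one_smul, mul_one, one_mul, smul_mul_assoc, mul_smul_comm, mul_assoc, smul_smul]; done)
      | simp only [swapScalar, swapCorr, h1, h2, hiu, h1', h2', hiu', h4, h5, lt_irrefl, and_true, true_and, and_false, false_and, and_self, if_true, if_false, ite_true, ite_false, zero_smul, mul_zero, zero_mul, add_zero, zero_add, smul_zero, one_smul, mul_one, one_mul, smul_mul_assoc, mul_smul_comm, mul_assoc, smul_smul]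
      · simp only [
          row i t v (Or.inr ⟨rfl, h2⟩) h5.1, assoc (row i t v (Or.inr ⟨rfl, h2⟩) h5.1),
          anti i t u j (Or.inr ⟨rfl, h2⟩) hiu h2, assoc (anti i t u j (Or.inr ⟨rfl, h2⟩) hiu h2),
          anti i v u j (Or.inr ⟨rfl, h4.1⟩) hiu h4.1,
          assoc (anti i v u j (Or.inr ⟨rfl, h4.1⟩) hiu h4.1), mul_add, add_mul, smul_mul_assoc,
          mul_smul_comm, mul_assoc, smul_add]
        match_scalars
        field_simp
        ring
      · simp only [
          anti i v u j (Or.inr ⟨rfl, h4.1⟩) hiu h4.1,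
          assoc (anti i v u j (Or.inr ⟨rfl, h4.1⟩) hiu h4.1), mul_add, add_mul, smul_mul_assoc,
          mul_smul_comm, mul_assoc, smul_add]
        match_scalars
        field_simp
      · simp only [
          anti i t u j (Or.inr ⟨rfl, h2⟩) hiu h2, assoc (anti i t u j (Or.inr ⟨rfl, h2⟩) hiu h2),
          row i v t (Or.inr ⟨rfl, h4.1⟩) h5.1, assoc (row i v t (Or.inr ⟨rfl, h4.1⟩) h5.1),
          anti i v u j (Or.inr ⟨rfl, h4.1⟩) hiu h4.1,
          assoc (anti i v u j (Or.inr ⟨rfl, h4.1⟩) hiu h4.1), mul_add, add_mul, smul_mul_assoc,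
          mul_smul_comm, mul_assoc, smul_add]
        match_scalars
        field_simp
  · rcases hpa with h2 | ⟨rfl, h2⟩
    · have h2' := h2.ne
      have h1' := h1.ne
      rcases tri j t with h3 | h3 | h3 <;> rcases tri j v with h4 | h4 | h4 <;>
      first
      | (exfalso; obtain ⟨h3, -⟩ := h3; order)
      | (exfalso; order)
      | (simp only [swapScalar, swapCorr, h1, h1.not_gt, h2, h1', h2', h3, h4, lt_irrefl, and_true, true_and, and_false, false_and, and_self, if_true, if_false, ite_true, ite_false, zero_smul, mul_zero, zero_mul, add_zero, zero_add, smul_zero, one_smul, mul_one, one_mul, smul_mul_assoc, mul_smul_comm, mul_assoc, smul_smul]; done)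
      | simp only [swapScalar, swapCorr, h1, h1.not_gt, h2, h1', h2', h3, h4, lt_irrefl, and_true, true_and, and_false, false_and, and_self, if_true, if_false, ite_true, ite_false, zero_smul, mul_zero, zero_mul, add_zero, zero_add, smul_zero, one_smul, mul_one, one_mul, smul_mul_assoc, mul_smul_comm, mul_assoc, smul_smul]
      · simp only [
          row s t v (Or.inl h2) h1, assoc (row s t v (Or.inl h2) h1),
          anti i v s t (Or.inr ⟨rfl, h4.1⟩) h2 h1,
          assoc (anti i v s t (Or.inr ⟨rfl, h4.1⟩) h2 h1),
          anti i v s j (Or.inr ⟨rfl, h4.1⟩) h2 h4.1,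
          assoc (anti i v s j (Or.inr ⟨rfl, h4.1⟩) h2 h4.1), col i s v (Or.inr ⟨rfl, h4.1⟩) h2,
          assoc (col i s v (Or.inr ⟨rfl, h4.1⟩) h2), row s j t (Or.inl h2) h3.1,
          assoc (row s j t (Or.inl h2) h3.1), row s j v (Or.inl h2) h4.1,
          assoc (row s j v (Or.inl h2) h4.1), col i s t (Or.inr ⟨rfl, h3.1⟩) h2,
          assoc (col i s t (Or.inr ⟨rfl, h3.1⟩) h2), row i t v (Or.inr ⟨rfl, h3.1⟩) h1,
          assoc (row i t v (Or.inr ⟨rfl, h3.1⟩) h1), anti i t s j (Or.inr ⟨rfl, h3.1⟩) h2 h3.1,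
          assoc (anti i t s j (Or.inr ⟨rfl, h3.1⟩) h2 h3.1),
          diag i t s v (Or.inr ⟨rfl, h3.1⟩) h2 h1,
          assoc (diag i t s v (Or.inr ⟨rfl, h3.1⟩) h2 h1), mul_add, add_mul, smul_mul_assoc,
          mul_smul_comm, mul_assoc, smul_add]
        match_scalars <;> field_simp <;> ring
      · simp only [
          anti i v s t (Or.inr ⟨rfl, h4.1⟩) h2 h1,
          assoc (anti i v s t (Or.inr ⟨rfl, h4.1⟩) h2 h1), mul_add, add_mul, smul_mul_assoc,
          mul_smul_comm, mul_assoc, smul_add]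
        match_scalars
        field_simp
      · simp only [
          row s t j (Or.inl h2) h3.1, assoc (row s t j (Or.inl h2) h3.1),
          anti i v s t (Or.inr ⟨rfl, h4.1⟩) h2 h1,
          assoc (anti i v s t (Or.inr ⟨rfl, h4.1⟩) h2 h1),
          anti i v s j (Or.inr ⟨rfl, h4.1⟩) h2 h4.1,
          assoc (anti i v s j (Or.inr ⟨rfl, h4.1⟩) h2 h4.1), mul_add, add_mul, smul_mul_assoc,
          mul_smul_comm, mul_assoc, smul_add]
        match_scalars
        field_simp
    -- With all three letters in one row every correction vanishes.
    · simp [swapCorr]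
end QuantumMatrixAlgebra

/-! ### Lexicographic numbering of the matrix entries. -/

section MatrixIndex

/-- The row and column of the `k`-th generator in the lexicographic order. -/
def matrixIndex (n : ℕ) [NeZero n] (k : ℕ) : Fin n × Fin n := (Fin.ofNat n (k / n), Fin.ofNat n (k % n))

/-- The position of a matrix entry in the lexicographic order. -/
def matrixRank {n : ℕ} (p : Fin n × Fin n) : ℕ := n * p.1 + p.2

variable {n : ℕ}

theorem matrixRank_lt_iff {p r : Fin n × Fin n} : matrixRank p < matrixRank r ↔ toLex p < toLex r := by
  rw [Prod.Lex.toLex_lt_toLex]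
  obtain ⟨⟨i, hi⟩, ⟨j, hj⟩⟩ := p
  obtain ⟨⟨s, hs⟩, ⟨t, ht⟩⟩ := r
  simp only [matrixRank, Fin.mk_lt_mk, Fin.mk.injEq]
  rcases lt_trichotomy i s with h | rfl | h
  · have : n * (i + 1) ≤ n * s := Nat.mul_le_mul_left n h
    rw [mul_add] at this
    exact iff_of_true (by omega) (Or.inl h)
  · simp
  · have : n * (s + 1) ≤ n * i := Nat.mul_le_mul_left n h
    rw [mul_add] at this
    exact iff_of_false (by omega) (by omega)

theorem matrixRank_lt (p : Fin n × Fin n) : matrixRank p < n * n := by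
  have : n * (p.1 + 1) ≤ n * n := Nat.mul_le_mul_left n p.1.2
  rw [mul_add] at this
  have := p.2.2
  unfold matrixRank
  omega

variable [NeZero n]

theorem matrixIndex_matrixRank (p : Fin n × Fin n) : matrixIndex n (matrixRank p) = p := by
  have h1 : (n * (p.1 : ℕ) + p.2) / n = p.1 := by
    rw [Nat.mul_add_div (NeZero.pos n), Nat.div_eq_of_lt p.2.2, add_zero]
  have h2 : (n * (p.1 : ℕ) + p.2) % n = p.2 := by
    rw [Nat.mul_add_mod, Nat.mod_eq_of_lt p.2.2]
  ext <;> simp [matrixIndex, matrixRank, h1, h2]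

theorem matrixRank_matrixIndex {k : ℕ} (hk : k < n * n) : matrixRank (matrixIndex n k) = k := by
  have h1 : k / n < n := Nat.div_lt_of_lt_mul hk
  simp [matrixIndex, matrixRank, Nat.mod_eq_of_lt h1, Nat.div_add_mod]

end MatrixIndex

/-! ### Skew polynomials as a module. -/

section SkewShift

variable {K B : Type*} [Field K] [Ring B] [Algebra K B]

/-- Left multiplication by `X` on the left module `⨁ B X ^ j` of skew polynomials, where
`X b = ρ b 0 0 X + ρ b 0 1`. -/
def skewShift (ρ : B →ₐ[K] Matrix (Fin 2) (Fin 2) B) : Module.End K (ℕ →₀ B) :=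
  Finsupp.lsum K fun j =>
    Finsupp.lsingle (j + 1) ∘ₗ Matrix.entryLinearMap K B 0 0 ∘ₗ ρ.toLinearMap
      + Finsupp.lsingle j ∘ₗ Matrix.entryLinearMap K B 0 1 ∘ₗ ρ.toLinearMap

theorem skewShift_single (ρ : B →ₐ[K] Matrix (Fin 2) (Fin 2) B) (j : ℕ) (b : B) :
    skewShift ρ (Finsupp.single j b) =
      Finsupp.single (j + 1) (ρ b 0 0) + Finsupp.single j (ρ b 0 1) := by
  simp [skewShift]

/-- Multiplication by scalars on the left module of skew polynomials. -/
def skewScalar (K B : Type*) [Field K] [Ring B] [Algebra K B] : B →ₐ[K] Module.End K (ℕ →₀ B) :=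
  Algebra.lsmul K K (ℕ →₀ B)

theorem skewScalar_single (b : B) (j : ℕ) (y : B) :
    skewScalar K B b (Finsupp.single j y) = Finsupp.single j (b * y) := by
  simp [skewScalar, -Finsupp.single_mul]

/-- Multiplicativity of the upper triangular `ρ = (σ, δ; 0, id)` encodes both that `σ` is
multiplicative and the twisted Leibniz rule for `δ`; evaluated on `b * y` it is the Ore relation `X
b = σ(b) X + δ(b)`. -/
theorem skewShift_mul_skewScalar {ρ : B →ₐ[K] Matrix (Fin 2) (Fin 2) B} (hρ : ∀ b, ρ b 1 0 = 0 ∧ ρ b 1 1 = b)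
    (b : B) : skewShift ρ * skewScalar K B b =
      skewScalar K B (ρ b 0 0) * skewShift ρ + skewScalar K B (ρ b 0 1) := by
  refine Finsupp.lhom_ext fun j y => ?_
  simp only [LinearMap.add_apply, Module.End.mul_apply, skewScalar_single, skewShift_single, map_add,
    map_mul, Matrix.mul_apply, Fin.sum_univ_two, hρ, mul_zero, add_zero,
    Finsupp.single_add, add_assoc]

theorem skewShift_pow_single (ρ : B →ₐ[K] Matrix (Fin 2) (Fin 2) B) (j : ℕ) :
    (skewShift ρ ^ j) (Finsupp.single 0 1) = Finsupp.single j 1 := by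
  induction j with
  | zero => simp
  | succ j ih => rw [pow_succ', Module.End.mul_apply, ih, skewShift_single]; simp

end SkewShift

theorem map_orderedMonomial {A B F : Type*} [Monoid A] [Monoid B] [FunLike F A B]
    [MonoidHomClass F A B] (f : F) {x : ℕ → A} {y : ℕ → B} {m : ℕ} {a : ℕ → ℕ}
    (h : ∀ i < m, a i ≠ 0 → f (x i) = y i) : f (orderedMonomial x m a) = orderedMonomial y m a := by
  induction m with
  | zero => exact map_one f
  | succ m ih =>
    rw [orderedMonomial, orderedMonomial, map_mul, map_pow,
      ih fun i hi => h i (hi.trans m.lt_succ_self)]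
    by_cases h0 : a m = 0
    · simp [h0]
    · rw [h m m.lt_succ_self h0]

theorem adjoin_range_mkAlgHom {K ι : Type*} [Field K] (r : FreeAlgebra K ι → FreeAlgebra K ι → Prop) :
    Algebra.adjoin K (Set.range fun i => RingQuot.mkAlgHom K r (FreeAlgebra.ι K i)) = ⊤ := by
  rw [Set.range_comp' (RingQuot.mkAlgHom K r) (FreeAlgebra.ι K), ← AlgHom.map_adjoin, FreeAlgebra.adjoin_range_ι, Algebra.map_top,
    AlgHom.range_eq_top]
  exact RingQuot.mkAlgHom_surjective K r

namespace QuantumMatrixAlgebra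

/-! ### Linear independence of the ordered monomials. -/

section Tower

variable {K : Type u} [Field K] {n : ℕ}

/-- The relations of the quantized matrix algebra, for the letters from position `k` on. -/
def SatisfiesRel {B : Type*} [Ring B] [Algebra K B] (q : K) (k : ℕ) (w : Fin n × Fin n → B) : Prop :=
  ∀ a b : Fin n × Fin n, k ≤ matrixRank a → toLex a < toLex b →
    w a * w b = swapScalar q a b • (w b * w a) + swapCorr q a b • (w (a.1, b.2) * w (b.1, a.2))

/-- The relations of the quantized matrix algebra which only involve letters from position `k` on. -/
inductive UpperRel (n : ℕ) (q : K) (k : ℕ) :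
    FreeAlgebra K (Fin n × Fin n) → FreeAlgebra K (Fin n × Fin n) → Prop
  | mk (a b : Fin n × Fin n) (hk : k ≤ matrixRank a) (hab : toLex a < toLex b) : UpperRel n q k
      (FreeAlgebra.ι K a * FreeAlgebra.ι K b)
      (swapScalar q a b • (FreeAlgebra.ι K b * FreeAlgebra.ι K a)
        + swapCorr q a b • (FreeAlgebra.ι K (a.1, b.2) * FreeAlgebra.ι K (b.1, a.2)))

/-- The algebra on all the letters, subject to the relations between the letters from position `k` on. -/
abbrev UpperAlgebra (n : ℕ) (q : K) (k : ℕ) : Type u := RingQuot (UpperRel n q k)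

/-- The generators of `UpperAlgebra`. -/
def upperGen (n : ℕ) (q : K) (k : ℕ) (p : Fin n × Fin n) : UpperAlgebra n q k :=
  RingQuot.mkAlgHom K (UpperRel n q k) (FreeAlgebra.ι K p)

theorem upperGen_satisfiesRel (q : K) (k : ℕ) : SatisfiesRel q k (upperGen n q k) := fun a b hk hab => by
  simpa [upperGen] using RingQuot.mkAlgHom_rel K (UpperRel.mk (q := q) a b hk hab)

variable {B : Type*} [Ring B] [Algebra K B]

/-- The universal property of `UpperAlgebra`. -/
def upperLift {q : K} {k : ℕ} {w : Fin n × Fin n → B} (hw : SatisfiesRel q k w) :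
    UpperAlgebra n q k →ₐ[K] B :=
  RingQuot.liftAlgHom K ⟨FreeAlgebra.lift K w, by
    rintro _ _ ⟨a, b, hk, hab⟩
    simpa using hw a b hk hab⟩

@[simp]
theorem upperLift_gen {q : K} {k : ℕ} {w : Fin n × Fin n → B} (hw : SatisfiesRel q k w)
    (p : Fin n × Fin n) : upperLift hw (upperGen n q k p) = w p := by
  simp [upperLift, upperGen]

theorem upper_induction {q : K} {k : ℕ} {P : UpperAlgebra n q k → Prop}
    (gen : ∀ p, P (upperGen n q k p)) (scalar : ∀ r, P (algebraMap K _ r))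
    (add : ∀ a b, P a → P b → P (a + b)) (mul : ∀ a b, P a → P b → P (a * b))
    (a : UpperAlgebra n q k) : P a := by
  have ha : a ∈ Algebra.adjoin K (Set.range (upperGen n q k)) := by
    rw [show upperGen n q k = fun p => RingQuot.mkAlgHom K (UpperRel n q k) (FreeAlgebra.ι K p)
      from rfl, adjoin_range_mkAlgHom]
    trivial
  induction ha using Algebra.adjoin_induction with
  | mem x hx => obtain ⟨p, rfl⟩ := hx; exact gen p
  | algebraMap r => exact scalar r
  | add a b _ _ ha hb => exact add a b ha hb
  | mul a b _ _ ha hb => exact mul a b ha hb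

/-- The diagonal entries hold because the scalars depend on rows and columns separately, so `{a, b}`
and the opposite corners of its rectangle get the same factor. The upper right entry is
`skewDerivation_rel`. -/
theorem skewMatrix_satisfiesRel {q : K} (hq : q ≠ 0) {p : Fin n × Fin n} {w : Fin n × Fin n → B}
    (hw : SatisfiesRel q (matrixRank p + 1) w) :
    SatisfiesRel q (matrixRank p + 1) fun a =>
      !![swapScalar q p a • w a, swapCorr q p a • (w (p.1, a.2) * w (a.1, p.2)); 0, w a] := by
  intro a b hk hab
  have h01 := skewDerivation_rel hq w p
    (fun a b hpa hab => hw a b (matrixRank_lt_iff.2 hpa) hab) a b (matrixRank_lt_iff.1 hk) hab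
  have h00 : (swapScalar q p a • w a) * (swapScalar q p b • w b) =
      swapScalar q a b • ((swapScalar q p b • w b) * (swapScalar q p a • w a))
        + swapCorr q a b • ((swapScalar q p (a.1, b.2) • w (a.1, b.2)) *
          (swapScalar q p (b.1, a.2) • w (b.1, a.2))) := by
    have : swapScalar q p (a.1, b.2) * swapScalar q p (b.1, a.2) =
        swapScalar q p a * swapScalar q p b := by
      simp only [swapScalar]; ring
    simp only [smul_mul_smul_comm, hw a b hk hab, this, smul_add, smul_smul]
    congr 2 <;> ring_nf
  have h11 := hw a b hk hab
  ext i j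
  fin_cases i <;> fin_cases j
  · simpa [Matrix.mul_apply, Fin.sum_univ_two, smul_smul, mul_comm, mul_left_comm, mul_assoc] using h00
  · simpa [Matrix.mul_apply, Fin.sum_univ_two, smul_smul, mul_comm, mul_left_comm, mul_assoc] using h01
  · simp [Matrix.mul_apply, Fin.sum_univ_two]
  · simpa [Matrix.mul_apply, Fin.sum_univ_two] using h11

/-- The action of the letters on skew polynomials in `z_p`. -/
def skewAction (ρ : B →ₐ[K] Matrix (Fin 2) (Fin 2) B) (p : Fin n × Fin n) (w : Fin n × Fin n → B)
    (a : Fin n × Fin n) : Module.End K (ℕ →₀ B) :=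
  if a = p then skewShift ρ else skewScalar K B (w a)

/-- Relations starting at `z_p` are the Ore relation; the others are inherited from `B`. -/
theorem skewAction_satisfiesRel {q : K} {ρ : B →ₐ[K] Matrix (Fin 2) (Fin 2) B} {p : Fin n × Fin n}
    {w : Fin n × Fin n → B} (hw : SatisfiesRel q (matrixRank p + 1) w) (hρ : ∀ b, ρ b 1 0 = 0 ∧ ρ b 1 1 = b)
    (hρw : ∀ a, ρ (w a) =
      !![swapScalar q p a • w a, swapCorr q p a • (w (p.1, a.2) * w (a.1, p.2)); 0, w a]) :
    SatisfiesRel q (matrixRank p) (skewAction ρ p w) := by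
  intro a b hk hab
  have hne : ∀ r, toLex p < toLex r → skewAction ρ p w r = skewScalar K B (w r) := fun r hr =>
    if_neg fun h => by simp [h] at hr
  -- A nonzero correction only involves letters strictly after `a`, hence after `p`, which act as
  -- scalars.
  have hcorr : swapCorr q a b • (skewAction ρ p w (a.1, b.2) * skewAction ρ p w (b.1, a.2)) =
      skewScalar K B (swapCorr q a b • (w (a.1, b.2) * w (b.1, a.2))) := by
    by_cases h : a.1 < b.1 ∧ a.2 < b.2
    · have hpa : toLex p ≤ toLex a := not_lt.1 fun h => hk.not_gt (matrixRank_lt_iff.2 h)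
      rw [hne _ (hpa.trans_lt (by simp [Prod.Lex.toLex_lt_toLex, h])),
        hne _ (hpa.trans_lt (by simp [Prod.Lex.toLex_lt_toLex, h])), map_smul, map_mul]
    · simp [swapCorr, h]
  rcases hk.eq_or_lt with hk | hk
  · obtain rfl : p = a := by
      rcases lt_trichotomy (toLex p) (toLex a) with h | h | h
      · exact absurd hk (matrixRank_lt_iff.2 h).ne
      · exact toLex.injective h
      · exact absurd hk (matrixRank_lt_iff.2 h).ne'
    rw [hcorr, hne b hab, skewAction, if_pos rfl, skewShift_mul_skewScalar hρ]
    simp [hρw]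
  · have hpa := matrixRank_lt_iff.1 hk
    rw [hcorr, hne a hpa, hne b (hpa.trans hab), ← map_mul, ← map_mul, ← map_smul, ← map_add,
      hw a b hk hab]

variable [NeZero n]

/-- Acting on the vector `1` in degree zero sends a later monomial `u` times `z_p ^ j` to `u X ^ j`.
The exponent `j` is read off from the degree and the others from the coordinates on `B`. -/
theorem exists_coord_of_skewMatrix {q : K} {ρ : B →ₐ[K] Matrix (Fin 2) (Fin 2) B}
    {p : Fin n × Fin n} {w : Fin n × Fin n → B} {k : ℕ} (hkp : matrixRank p = k) (hw : SatisfiesRel q (k + 1) w)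
    (hρ : ∀ b, ρ b 1 0 = 0 ∧ ρ b 1 1 = b) (hρw : ∀ a, ρ (w a) =
      !![swapScalar q p a • w a, swapCorr q p a • (w (p.1, a.2) * w (a.1, p.2)); 0, w a])
    {c : B →ₗ[K] ((ℕ → ℕ) →₀ K)} (hc : ∀ a : ℕ → ℕ, (∀ i, i < k + 1 ∨ n * n ≤ i → a i = 0) →
      c (orderedMonomial (fun i => w (matrixIndex n i)) (n * n) a) = Finsupp.single a 1) :
    ∃ c : UpperAlgebra n q k →ₗ[K] ((ℕ → ℕ) →₀ K), ∀ a : ℕ → ℕ,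
      (∀ i, i < k ∨ n * n ≤ i → a i = 0) →
        c (orderedMonomial (fun i => upperGen n q k (matrixIndex n i)) (n * n) a) =
          Finsupp.single a 1 := by
  have hk : k < n * n := hkp ▸ matrixRank_lt p
  have hs : SatisfiesRel q k (skewAction ρ p w) :=
    hkp ▸ skewAction_satisfiesRel (hkp.symm ▸ hw) hρ hρw
  let θ := upperLift hs
  refine ⟨(Finsupp.lsum K fun j =>
      Finsupp.lmapDomain K K (fun a => Function.update a k j) ∘ₗ c) ∘ₗ
    LinearMap.applyₗ (Finsupp.single 0 1) ∘ₗ θ.toLinearMap, fun a ha => ?_⟩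
  have hupper : ∀ i, i < k + 1 ∨ n * n ≤ i → upperPart (k + 1) a i = 0 := fun i hi => by
    by_cases h : k + 1 ≤ i
    · rw [upperPart_of_le a h, ha i (by omega)]
    · exact upperPart_of_lt a (by omega)
  have hsplit : orderedMonomial (fun i => upperGen n q k (matrixIndex n i)) (n * n) a =
      orderedMonomial (fun i => upperGen n q k (matrixIndex n i)) (n * n) (upperPart (k + 1) a) *
        upperGen n q k p ^ a k := by
    rw [orderedMonomial_split _ (Nat.succ_le_of_lt hk), orderedMonomial, ← hkp, matrixIndex_matrixRank, hkp,
      orderedMonomial_congr _ (a := a) (b := 0) fun i hi => ha i (Or.inl hi), orderedMonomial_zero,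
      mul_one]
  have hθ : θ (orderedMonomial (fun i => upperGen n q k (matrixIndex n i)) (n * n)
      (upperPart (k + 1) a)) = skewScalar K B
        (orderedMonomial (fun i => w (matrixIndex n i)) (n * n) (upperPart (k + 1) a)) := by
    rw [map_orderedMonomial θ (y := fun i => skewScalar K B (w (matrixIndex n i))),
      map_orderedMonomial (skewScalar K B) fun i _ _ => rfl]
    intro i hi hi0
    have : matrixIndex n i ≠ p := by
      rintro rfl
      exact hi0 (upperPart_of_lt a (by rw [← hkp, matrixRank_matrixIndex hi]; exact Nat.lt_succ_self _))
    simp [θ, skewAction, this]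
  have hp : θ (upperGen n q k p) = skewShift ρ := by simp [θ, skewAction]
  have hupdate : Function.update (upperPart (k + 1) a) k (a k) = a := by
    ext i
    rcases lt_trichotomy i k with h | rfl | h
    · rw [Function.update_of_ne h.ne, hupper i (by omega), ha i (Or.inl h)]
    · simp
    · rw [Function.update_of_ne h.ne', upperPart_of_le a h]
  simp [hsplit, hθ, hp, skewShift_pow_single, skewScalar_single, hc _ hupper, hupdate]

theorem exists_upper_coord {q : K} (hq : q ≠ 0) {k : ℕ} (hk : k ≤ n * n) :
    ∃ c : UpperAlgebra n q k →ₗ[K] ((ℕ → ℕ) →₀ K), ∀ a : ℕ → ℕ,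
      (∀ i, i < k ∨ n * n ≤ i → a i = 0) →
        c (orderedMonomial (fun i => upperGen n q k (matrixIndex n i)) (n * n) a) =
          Finsupp.single a 1 := by
  induction hk using Nat.decreasingInduction with
  | self =>
    -- No letters remain at the end of the tower, so only the constant coefficient of the empty
    -- monomial has to be detected; sending every letter to `0` does this.
    have h0 : SatisfiesRel q (n * n) (0 : Fin n × Fin n → K) := fun a b _ _ => by simp
    refine ⟨Finsupp.lsingle 0 ∘ₗ (upperLift h0).toLinearMap, fun a ha => ?_⟩
    obtain rfl : a = 0 := funext fun i => ha i (lt_or_ge _ _)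
    simp [orderedMonomial_zero]
  | of_succ k hk ih =>
    obtain ⟨p, rfl⟩ : ∃ p : Fin n × Fin n, matrixRank p = k := ⟨_, matrixRank_matrixIndex hk⟩
    obtain ⟨c, hc⟩ := ih
    have hw := upperGen_satisfiesRel (n := n) q (matrixRank p + 1)
    have hρ : ∀ b, upperLift (skewMatrix_satisfiesRel hq hw) b 1 0 = 0 ∧
        upperLift (skewMatrix_satisfiesRel hq hw) b 1 1 = b := fun b => by
      induction b using upper_induction with
      | gen r => simp
      | scalar r => simp [Matrix.algebraMap_matrix_apply]
      | add a b ha hb => simp [ha, hb]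
      | mul a b ha hb => simp [Matrix.mul_apply, Fin.sum_univ_two, ha, hb]
    exact exists_coord_of_skewMatrix rfl hw hρ (upperLift_gen _) hc

end Tower

end QuantumMatrixAlgebra

/-! ### Universal property and symmetries of `M_q(n)`. -/

namespace QuantumMatrixAlgebra

variable {K : Type u} [Field K] {n : ℕ}

theorem z_satisfiesRel (q : K) : SatisfiesRel q 0 (z n q) := by
  rintro ⟨i, j⟩ ⟨s, t⟩ - hab
  rw [Prod.Lex.toLex_lt_toLex] at hab
  simp only at hab
  rcases hab with his | ⟨rfl, hjt⟩
  · rcases lt_trichotomy j t with hjt | rfl | htj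
    · simpa [z, swapScalar, swapCorr, his, hjt, his.ne, hjt.ne] using
        RingQuot.mkAlgHom_rel K (QuantumMatrixRel.diag (q := q) i j s t his hjt)
    · simpa [z, swapScalar, swapCorr, his.ne] using
        RingQuot.mkAlgHom_rel K (QuantumMatrixRel.col (q := q) i s j his)
    · simpa [z, swapScalar, swapCorr, htj.not_gt, his.ne, htj.ne'] using
        RingQuot.mkAlgHom_rel K (QuantumMatrixRel.anti (q := q) i j s t his htj)
  · simpa [z, swapScalar, swapCorr, hjt.ne] using
      RingQuot.mkAlgHom_rel K (QuantumMatrixRel.row (q := q) i j t hjt)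

section Lift

variable {B : Type*} [Ring B] [Algebra K B]

/-- The universal property of the quantized matrix algebra. -/
def lift {q : K} {w : Fin n × Fin n → B} (hw : SatisfiesRel q 0 w) :
    QuantumMatrixAlgebra n q →ₐ[K] B :=
  RingQuot.liftAlgHom K ⟨FreeAlgebra.lift K w, by
    rintro _ _ (⟨i, j, t, h⟩ | ⟨i, s, j, h⟩ | ⟨i, j, s, t, h, h'⟩ | ⟨i, j, s, t, h, h'⟩)
    · simpa [swapScalar, swapCorr, h.ne] using
        hw (i, j) (i, t) (Nat.zero_le _) (by simpa [Prod.Lex.toLex_lt_toLex] using h)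
    · simpa [swapScalar, swapCorr, h.ne] using
        hw (i, j) (s, j) (Nat.zero_le _) (by simpa [Prod.Lex.toLex_lt_toLex] using h)
    · simpa [swapScalar, swapCorr, h'.not_gt, h.ne, h'.ne'] using
        hw (i, j) (s, t) (Nat.zero_le _) (by simp [Prod.Lex.toLex_lt_toLex, h])
    · simpa [swapScalar, swapCorr, h, h', h.ne, h'.ne] using
        hw (i, j) (s, t) (Nat.zero_le _) (by simp [Prod.Lex.toLex_lt_toLex, h])⟩

@[simp]
theorem lift_z {q : K} {w : Fin n × Fin n → B} (hw : SatisfiesRel q 0 w) (p : Fin n × Fin n) :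
    lift hw (z n q p) = w p := by
  simp [lift, z]

/-- All products in a relation use the same two rows and the same two columns, so row and column
rescalings multiply each term equally. The twists `σ` are of this kind. -/
theorem SatisfiesRel.smul {q : K} {k : ℕ} {w : Fin n × Fin n → B} (hw : SatisfiesRel q k w)
    (r s : Fin n → K) : SatisfiesRel q k fun a => (r a.1 * s a.2) • w a := by
  intro a b hk hab
  simp only [smul_mul_smul_comm, hw a b hk hab, smul_add, smul_smul]
  congr 2 <;> ring

end Lift

theorem adjoin_range_z (q : K) : Algebra.adjoin K (Set.range (z n q)) = ⊤ :=
  adjoin_range_mkAlgHom _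

/-- Reversing rows and columns reverses the lexicographic order, which compensates for reversing
products; the scalar and correction coefficients are unchanged. -/
theorem opposite_satisfiesRel (q : K) : SatisfiesRel q 0 fun a =>
    MulOpposite.op (z n q (a.1.rev, a.2.rev)) := by
  intro a b _ hab
  have := z_satisfiesRel q (b.1.rev, b.2.rev) (a.1.rev, a.2.rev) (Nat.zero_le _) (by
    rw [Prod.Lex.toLex_lt_toLex] at hab ⊢
    simpa [eq_comm] using hab)
  rw [show swapScalar q (b.1.rev, b.2.rev) (a.1.rev, a.2.rev) = swapScalar q a b by
      simp [swapScalar, eq_comm],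
    show swapCorr q (b.1.rev, b.2.rev) (a.1.rev, a.2.rev) = swapCorr q a b by simp [swapCorr]] at this
  exact congrArg MulOpposite.op this

theorem opposite_involutive (q : K) (a : QuantumMatrixAlgebra n q) :
    (lift (opposite_satisfiesRel q) (lift (opposite_satisfiesRel q) a).unop).unop = a := by
  have ha : a ∈ Algebra.adjoin K (Set.range (z n q)) := by rw [adjoin_range_z]; trivial
  induction ha using Algebra.adjoin_induction with
  | mem x hx => obtain ⟨p, rfl⟩ := hx; simp
  | algebraMap r => simp [MulOpposite.algebraMap_apply]
  | add a b _ _ ha hb => simp [ha, hb]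
  | mul a b _ _ ha hb => simp [ha, hb]

/-- Reversing the rows and the columns is an anti-automorphism. -/
def opEquiv (n : ℕ) (q : K) : QuantumMatrixAlgebra n q ≃+* (QuantumMatrixAlgebra n q)ᵐᵒᵖ :=
  { (lift (opposite_satisfiesRel q)).toRingHom with
    invFun := fun y => (lift (opposite_satisfiesRel q) y.unop).unop
    left_inv := opposite_involutive q
    right_inv := fun y => MulOpposite.unop_injective (opposite_involutive q y.unop) }

/-! ### `M_q(n)` as a quadratic skew PBW algebra. -/

section PBW

variable [NeZero n]

theorem image_matrixIndex (q : K) :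
    (fun i => z n q (matrixIndex n i)) '' Set.Iio (n * n) = Set.range (z n q) := by
  ext y
  constructor
  · rintro ⟨i, -, rfl⟩
    exact ⟨_, rfl⟩
  · rintro ⟨p, rfl⟩
    exact ⟨matrixRank p, matrixRank_lt p, by simp only [matrixIndex_matrixRank]⟩

theorem isQuadraticSkewPBW {q : K} (hq : q ≠ 0) :
    IsQuadraticSkewPBW K (fun i => z n q (matrixIndex n i)) (n * n) where
  adjoin_eq_top := by rw [image_matrixIndex, adjoin_range_z]
  twist k hk := by
    set p := matrixIndex n k
    refine ⟨lift ((z_satisfiesRel q).smul (fun i => if i = p.1 then q else 1)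
      fun j => if j = p.2 then q else 1), fun i hi => ?_⟩
    have hip : toLex (matrixIndex n i) < toLex p := by
      rwa [← matrixRank_lt_iff, matrixRank_matrixIndex (hi.trans hk), matrixRank_matrixIndex hk]
    have hrel := z_satisfiesRel q _ _ (Nat.zero_le _) hip
    refine ⟨swapScalar q (matrixIndex n i) p, swapCorr q (matrixIndex n i) p, ?_⟩
    by_cases h : (matrixIndex n i).1 < p.1 ∧ (matrixIndex n i).2 < p.2
    · refine ⟨matrixRank ((matrixIndex n i).1, p.2), matrixRank (p.1, (matrixIndex n i).2), ?_, ?_,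
        lift_z _ _, ?_⟩
      · rw [← matrixRank_matrixIndex hk, matrixRank_lt_iff]
        exact Prod.Lex.toLex_lt_toLex.2 (Or.inl h.1)
      · rw [← matrixRank_matrixIndex hk, matrixRank_lt_iff]
        exact Prod.Lex.toLex_lt_toLex.2 (Or.inr ⟨rfl, h.2⟩)
      · simpa only [matrixIndex_matrixRank] using hrel
    -- The correction coefficient is zero here, so any two earlier letters serve.
    · refine ⟨i, i, hi, hi, lift_z _ _, ?_⟩
      simpa [swapCorr, h] using hrel
  coord := by
    obtain ⟨c, hc⟩ := exists_upper_coord (n := n) hq (Nat.zero_le _)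
    refine ⟨c ∘ₗ (lift (upperGen_satisfiesRel q 0)).toLinearMap, fun a ha => ?_⟩
    rw [LinearMap.comp_apply, AlgHom.toLinearMap_apply, map_orderedMonomial _ fun i _ _ => lift_z _ _,
      hc a fun i hi => ha i (by omega)]
  degree := by
    have h : SatisfiesRel q 0 fun p => Polynomial.monomial 1 (z n q p) := fun a b _ hab => by
      simp only [Polynomial.monomial_mul_monomial, Polynomial.smul_monomial, ← map_add,
        z_satisfiesRel q a b (Nat.zero_le _) hab]
    exact ⟨lift h, fun i _ => lift_z _ _⟩
  augmentation := by
    have h : SatisfiesRel q 0 (0 : Fin n × Fin n → K) := fun a b _ _ => by simp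
    exact ⟨lift h, fun i _ => lift_z _ _⟩

theorem generatorSpan_pow (q : K) :
    (fun d => generatorSpan K (fun i => z n q (matrixIndex n i)) (n * n) ^ d) = grading n q := by
  funext d
  rw [grading, generatorSpan, image_matrixIndex]

end PBW

/-! ### Quadratic presentation. -/

theorem z_mem_grading_one (q : K) (p : Fin n × Fin n) : z n q p ∈ grading n q 1 := by
  rw [grading, pow_one]
  exact Submodule.subset_span ⟨p, rfl⟩

theorem tensorAlgebra_lift_surjective (q : K) :
    Function.Surjective (TensorAlgebra.lift K (grading n q 1).subtype) := by
  rw [← AlgHom.range_eq_top, eq_top_iff, ← adjoin_range_z, Algebra.adjoin_le_iff]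
  rintro _ ⟨p, rfl⟩
  exact ⟨TensorAlgebra.ι K ⟨z n q p, z_mem_grading_one q p⟩, by simp⟩

/-- The defining relations are quadratic, so they already hold in the tensor algebra modulo the
ideal `J` of quadratic relations. This gives a map from `M_q(n)` back to that quotient, through
which the quotient map factors; hence the kernel lies in `J`. -/
theorem ker_tensorAlgebra_lift (q : K) :
    TwoSidedIdeal.ker (TensorAlgebra.lift K (grading n q 1).subtype) =
      TwoSidedIdeal.span
        {x | x ∈ LinearMap.range (TensorAlgebra.ι K (M := grading n q 1)) ^ 2 ∧
          TensorAlgebra.lift K (grading n q 1).subtype x = 0} := by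
  refine le_antisymm ?_ (TwoSidedIdeal.span_le.2 fun x hx => (TwoSidedIdeal.mem_ker _).2 hx.2)
  set J := TwoSidedIdeal.span
        {x | x ∈ LinearMap.range (TensorAlgebra.ι K (M := grading n q 1)) ^ 2 ∧
          TensorAlgebra.lift K (grading n q 1).subtype x = 0} with hJ
  let y : Fin n × Fin n → TensorAlgebra K (grading n q 1) := fun p =>
    TensorAlgebra.ι K ⟨z n q p, z_mem_grading_one q p⟩
  have hy : ∀ p, TensorAlgebra.lift K (grading n q 1).subtype (y p) = z n q p := fun p => by
    simp [y]
  have hy2 : ∀ p r, y p * y r ∈ LinearMap.range (TensorAlgebra.ι K (M := grading n q 1)) ^ 2 :=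
    fun p r => pow_two (LinearMap.range (TensorAlgebra.ι K (M := grading n q 1))) ▸
      Submodule.mul_mem_mul ⟨_, rfl⟩ ⟨_, rfl⟩
  have hrel : SatisfiesRel q 0 fun p => J.ringCon.mkₐ (α := K) (y p) := by
    intro a b _ hab
    simp only [← map_mul, ← map_smul, ← map_add]
    refine (RingCon.eq _).2 ((TwoSidedIdeal.rel_iff _ _ _).2 (TwoSidedIdeal.subset_span ⟨?_, ?_⟩))
    · exact Submodule.sub_mem _ (hy2 _ _)
        (Submodule.add_mem _ (Submodule.smul_mem _ _ (hy2 _ _)) (Submodule.smul_mem _ _ (hy2 _ _)))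
    · simp only [map_sub, map_add, map_mul, map_smul, hy,
        z_satisfiesRel q a b (Nat.zero_le _) hab, sub_self]
  have hcomp : (lift hrel).comp (TensorAlgebra.lift K (grading n q 1).subtype) =
      J.ringCon.mkₐ (α := K) := by
    refine TensorAlgebra.hom_ext (LinearMap.ext fun ⟨v, hv⟩ => ?_)
    have hv' : v ∈ Submodule.span K (Set.range (z n q)) := by rwa [grading, pow_one] at hv
    suffices ∀ h : v ∈ grading n q 1, lift hrel v = J.ringCon.mkₐ (α := K) (TensorAlgebra.ι K ⟨v, h⟩) by
      simpa using this hv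
    clear hv
    induction hv' using Submodule.span_induction with
    | mem v hv => obtain ⟨p, rfl⟩ := hv; exact fun _ => lift_z _ _
    | zero =>
      intro h
      rw [show (⟨0, h⟩ : grading n q 1) = 0 from rfl]
      simp
    | add a b ha hb iha ihb =>
      intro h
      have ha' : a ∈ grading n q 1 := by rwa [grading, pow_one]
      have hb' : b ∈ grading n q 1 := by rwa [grading, pow_one]
      rw [show (⟨a + b, h⟩ : grading n q 1) = ⟨a, ha'⟩ + ⟨b, hb'⟩ from rfl, map_add, map_add, map_add,
        iha ha', ihb hb']
    | smul r a ha iha =>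
      intro h
      have ha' : a ∈ grading n q 1 := by rwa [grading, pow_one]
      rw [show (⟨r • a, h⟩ : grading n q 1) = r • ⟨a, ha'⟩ from rfl, map_smul, map_smul, map_smul,
        iha ha']
  intro x hx
  have h0 : J.ringCon.mkₐ (α := K) x = J.ringCon.mkₐ (α := K) 0 := by
    rw [← hcomp, AlgHom.comp_apply, (TwoSidedIdeal.mem_ker _).1 hx, map_zero, map_zero]
  simpa using (TwoSidedIdeal.rel_iff _ _ _).1 ((RingCon.eq _).1 h0)

end QuantumMatrixAlgebra

end

theorem theorem3p3 {K : Type u} [Field K] [CharZero K] (n : ℕ) (hn : 2 ≤ n)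
    (q : K) (hq : q ≠ 0) :
    (IsConnectedGradedAlgebra (QuantumMatrixAlgebra.grading n q) ∧
      hilbertSeries (QuantumMatrixAlgebra.grading n q) =
        ((1 - PowerSeries.X : ℚ⟦X⟧) ^ (n ^ 2))⁻¹) ∧
    gelfandKirillovDimension K (QuantumMatrixAlgebra n q) = ((n ^ 2 : ℕ) : EReal) ∧
    (globalDimension (QuantumMatrixAlgebra n q) = ((n ^ 2 : ℕ) : WithBot ℕ∞) ∧
      globalDimension (QuantumMatrixAlgebra n q)ᵐᵒᵖ = ((n ^ 2 : ℕ) : WithBot ℕ∞)) ∧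
    IsClassicalKoszulAlgebra (QuantumMatrixAlgebra.grading n q) := by
  have : NeZero n := ⟨by omega⟩
  have hN : 2 ≤ n * n := hn.trans (Nat.le_mul_self n)
  have hx := QuantumMatrixAlgebra.isQuadraticSkewPBW (n := n) hq
  have hconnected := hx.isConnectedGradedAlgebra
  have hhilbert := hx.hilbertSeries_eq (by omega)
  have hkoszul := hx.nonempty_linearFreeResolution
  rw [QuantumMatrixAlgebra.generatorSpan_pow] at hconnected hhilbert hkoszul
  rw [pow_two]
  exact ⟨⟨hconnected, hhilbert⟩, hx.gelfandKirillovDimension_eq (by omega),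
    -- The right global dimension is transported along the anti-automorphism.
    ⟨hx.globalDimension_eq hN, (globalDimension_eq_of_ringEquiv
      (QuantumMatrixAlgebra.opEquiv n q)).symm.trans (hx.globalDimension_eq hN)⟩,
    ⟨hconnected, QuantumMatrixAlgebra.tensorAlgebra_lift_surjective q,
      QuantumMatrixAlgebra.ker_tensorAlgebra_lift q⟩, hkoszul⟩
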